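/- Let $d$ be a positive odd integer, $\ell=\sqrt{2\pi/d}$, $\omega=e^{2\pi i/d}$, and write $[\mathbf a,\mathbf b]=a_Xb_Z-a_Zb_X$. *Qudit side.* For $\mathbf a\in\mathbb Z_d^2$ put $\bar T_{\mathbf a}=\omega^{2^{-1}a_Xa_Z}X^{a_X}Z^{a_Z}$, where $X|j\rangle=|j+1\rangle$, $Z|j\rangle=\omega^j|j\rangle$ and $2^{-1}=(d+1)/2$. The Gross Wigner function of a density matrix $\bar\rho$ on $\mathbb C^d$ is $\bar W_{\bar\rho}(\mathbf t)=\frac1d\sum_{\mathbf a\in\mathbb Z_d^2}\omega^{-[\mathbf t,\mathbf a]}\operatorname{Tr}(\bar T_{\mathbf a}\bar\rho)$, $\mathbf t\in\mathbb Z_d^2$. *Continuous-variable side.* On $L^2(\mathbb R)$ put $T_{\mathbf a}=e^{i\pi a_Xa_Z/d}e^{-i\ell a_X\hat p}e^{i\ell a_Z\hat q}$. The Zak-Gross Wigner function of a trace-class operator $\rho$ is the distribution $W_\rho(\boldsymbol\eta)=\operatorname{Tr}(\rho A_{\boldsymbol\eta})$ on $\mathbb R^2$ ($d\ell$-periodic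 in each coordinate), where $A_{\boldsymbol\eta}=\frac1{2\pi}\sum_{\mathbf a\in\mathbb Z^2}e^{i\ell[\mathbf a,\boldsymbol\eta]+i\pi a_Xa_Z}T_{\mathbf a}$. *Ideal states.* The ideal GKP state perfectly encoding $\bar\rho$ is the non-normalizable operator $\rho_L=\sum_{j,k}\bar\rho_{jk}|j_{\mathrm{GKP}}\rangle\langle k_{\mathrm{GKP}}|$ with $|j_{\mathrm{GKP}}\rangle=\ell^{-1/2}\sum_{n\in\mathbb Z}|(dn+j)\ell\rangle$, $j\in\{0,\dots,d-1\}$, a tempered distribution in the position representation. Its trace is infinite, so $W_{\rho_L}$ is understood up to normalization: for Schwartz functions $g,h$ on $\mathbb R$ with $g(0)=1$, $\int h=1$ and $\varepsilon,\delta>0$, let $E_{\varepsilon,\delta}u=\delta^{-1}h(\cdot/\delta)*\big(g(\varepsilon\,\cdot)\,u\big)$ (for Gaussian $g,h$ this produces the usual finitely squeezed GKP states), and let $W_{\rho_L}$ be the limit, in the sense of tempered distributions as $\varepsilon,\delta\to0^+$ jointly, of $W_{\rho_{\varepsilon,\delta}}$, where $\rho_{\varepsilon,\delta}=E_{\varepsilon,\delta}\rho_LE_{\varepsilon,\delta}^\dagger/\operatorname{Tr}(E_{\varepsilon,\delta}\rho_LE_{\varepsilon,\delta}^\dagger)$.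 **Claim.** For every density matrix $\bar\rho$ on $\mathbb C^d$ the limit exists, is the same for all $g,h$ (the traces being nonzero for all small $\varepsilon,\delta$), and $$W_{\rho_L}(\boldsymbol\eta)=\sum_{\mathbf a\in\mathbb Z^2}\delta(\boldsymbol\eta-\ell\mathbf a)\,\bar W_{\bar\rho}(\mathbf a \bmod d)$$ as tempered distributions on $\mathbb R^2$. Consequently, if $\bar W_{\bar\rho}\ge0$ everywhere, then $W_{\rho_L}$ is a nonnegative distribution. In particular $W_{\rho_L}$ is nonnegative whenever $\bar\rho=|\psi\rangle\langle\psi|$ is a stabilizer state, i.e. $\psi$ is a unit vector spanning the joint $+1$ eigenspace of a subgroup of the Pauli group $\{\omega^k\bar T_{\mathbf a}\}$. -/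

import Mathlib

open MeasureTheory Filter Topology SchwartzMap
open scoped ComplexOrder ComplexConjugate ENNReal Matrix

noncomputable section

namespace ZakGross

/-! ### Qudits: Weyl operators, the Gross Wigner function, stabilizer states -/

section Qudit

variable (d : ℕ) [NeZero d]

/-- The primitive character `k ↦ ω ^ k`, `ω = exp (2 π i / d)`. -/
def omega (k : ZMod d) : ℂ := ZMod.stdAddChar k

/-- The shift `X |j⟩ = |j + 1⟩`. -/
def pauliX : Matrix (ZMod d) (ZMod d) ℂ := Matrix.of fun k j => if k = j + 1 then 1 else 0

/-- The clock `Z |j⟩ = ω ^ j |j⟩`. -/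
def pauliZ : Matrix (ZMod d) (ZMod d) ℂ := Matrix.diagonal fun j => omega d j

/-- The inverse of `2` modulo an odd `d`, i.e. `(d + 1) / 2`. -/
def half : ZMod d := (((d + 1) / 2 : ℕ) : ZMod d)

/-- The qudit displacement `ω ^ (2⁻¹ a_X a_Z) X ^ a_X Z ^ a_Z`. -/
def weyl (a : ZMod d × ZMod d) : Matrix (ZMod d) (ZMod d) ℂ :=
  omega d (half d * a.1 * a.2) • (pauliX d ^ a.1.val * pauliZ d ^ a.2.val)

/-- The symplectic form `[a, b] = a_X b_Z - a_Z b_X`. -/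
def symp {R : Type*} [CommRing R] (a b : R × R) : R := a.1 * b.2 - a.2 * b.1

/-- The qudit phase point operator `d⁻¹ ∑ₐ ω ^ (-[t, a]) T_a`. -/
def grossPhasePoint (t : ZMod d × ZMod d) : Matrix (ZMod d) (ZMod d) ℂ :=
  (1 / (d : ℂ)) • ∑ a : ZMod d × ZMod d, omega d (-symp t a) • weyl d a

/-- The Gross Wigner function `Tr (A_t ρ)`. -/
def grossWigner (ρ : Matrix (ZMod d) (ZMod d) ℂ) (t : ZMod d × ZMod d) : ℂ :=
  (grossPhasePoint d t * ρ).trace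

/-- Density matrices. -/
def IsState (ρ : Matrix (ZMod d) (ZMod d) ℂ) : Prop := ρ.PosSemidef ∧ ρ.trace = 1

/-- Pure stabilizer states: `ρ = |ψ⟩⟨ψ|` where the unit vector `ψ` spans the joint `+1` eigenspace
of a subgroup `S` of the Pauli group `{ω ^ k T_a}`. -/
def IsStabilizerState (ρ : Matrix (ZMod d) (ZMod d) ℂ) : Prop :=
  ∃ ψ : ZMod d → ℂ, star ψ ⬝ᵥ ψ = 1 ∧ ρ = Matrix.vecMulVec ψ (star ψ) ∧
    ∃ S : Subgroup (Matrix (ZMod d) (ZMod d) ℂ)ˣ,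
      (∀ P ∈ S, ∃ (k : ZMod d) (a : ZMod d × ZMod d),
        (P : Matrix (ZMod d) (ZMod d) ℂ) = omega d k • weyl d a) ∧
      ∀ v : ZMod d → ℂ,
        (∀ P ∈ S, (P : Matrix (ZMod d) (ZMod d) ℂ) *ᵥ v = v) ↔ ∃ c : ℂ, v = c • ψ

end Qudit

/-! ### One bosonic mode: displacements, trace, the Zak-Gross Wigner function -/

/-- The Hilbert space `L²(ℝ)` of one mode, in the position representation. -/
abbrev Mode : Type := Lp ℂ 2 (volume : Measure ℝ)

/-- The phase space `ℝ²`; coordinate `0` is position-like (`X`), coordinate `1` momentum-like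
(`Z`). -/
abbrev Phase : Type := EuclideanSpace ℝ (Fin 2)

/-- The trace `∑ᵢ ⟨eᵢ, A eᵢ⟩` over an orthonormal basis (of whose choice it does not depend when `A`
is of trace class). -/
def trace (A : Mode →L[ℂ] Mode) : ℂ :=
  ∑' i, inner ℂ ((exists_hilbertBasis ℂ Mode).choose_spec.choose i)
    (A ((exists_hilbertBasis ℂ Mode).choose_spec.choose i))

/-- The lattice constant `ℓ = √(2 π / d)`. -/
def ell (d : ℕ) : ℝ := Real.sqrt (2 * Real.pi / d)

/-- The translation `exp (-i c p) : ψ ↦ ψ (· - c)`. -/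
def translation (c : ℝ) : Mode →L[ℂ] Mode :=
  (Lp.compMeasurePreservingₗᵢ ℂ (fun x : ℝ => x - c)
    (measurePreserving_sub_right volume c)).toContinuousLinearMap

theorem memLp_phase (c : ℝ) :
    MemLp (fun x : ℝ => Complex.exp (Complex.I * c * x)) ∞ (volume : Measure ℝ) := by
  refine memLp_top_of_bound (Continuous.aestronglyMeasurable (by fun_prop)) 1 (.of_forall ?_)
  intro x
  rw [Complex.norm_exp]
  simp

/-- The modulation `exp (i c q) : ψ ↦ exp (i c ·) ψ`. -/
def modulation (c : ℝ) : Mode →L[ℂ] Mode :=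
  (ContinuousLinearMap.mul ℂ ℂ).holderL (volume : Measure ℝ) ∞ 2 2 (memLp_phase c).toLp

/-- The displacement `T_a = exp (i π a_X a_Z / d) exp (-i ℓ a_X p) exp (i ℓ a_Z q)`. -/
def displacement (d : ℕ) (a : ℝ × ℝ) : Mode →L[ℂ] Mode :=
  Complex.exp (Complex.I * Real.pi * a.1 * a.2 / d) •
    (translation (ell d * a.1) ∘L modulation (ell d * a.2))

/-- The phase point operator
`A_η = (2 π)⁻¹ ∑_{a ∈ ℤ²} exp (i ℓ [a, η] + i π a_X a_Z) T_a`
is an operator-valued distribution in `η`; this is `∫ f(η) A_η dη`, for a test function `f`. The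
series converges absolutely in operator norm. -/
def phasePoint (d : ℕ) (f : 𝓢(Phase, ℂ)) : Mode →L[ℂ] Mode :=
  (1 / (2 * Real.pi) : ℂ) • ∑' a : ℤ × ℤ,
    (∫ η : Phase, f η * Complex.exp (Complex.I * ell d * symp ((a.1 : ℝ), (a.2 : ℝ)) (η 0, η 1)
      + Complex.I * Real.pi * a.1 * a.2)) • displacement d ((a.1 : ℝ), (a.2 : ℝ))

/-- The Zak-Gross Wigner function `W_ρ(η) = Tr (ρ A_η)` of a trace-class operator, as a
distribution: the value of `∫ f(η) W_ρ(η) dη`. -/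
def zakGross (d : ℕ) (ρ : Mode →L[ℂ] Mode) (f : 𝓢(Phase, ℂ)) : ℂ :=
  trace (ρ ∘L phasePoint d f)

/-! ### Non-normalizable states and ideal GKP encoding -/

/-- Generalized operators: continuous linear maps from test functions to tempered distributions. -/
abbrev GenOp : Type := 𝓢(ℝ, ℂ) →L[ℂ] 𝓢'(ℝ, ℂ)

/-- Complex conjugation of test functions. -/
def schwartzConj : 𝓢(ℝ, ℂ) →L[ℝ] 𝓢(ℝ, ℂ) :=
  postcompCLM (𝕜 := ℝ) (Complex.conjCLE : ℂ →L[ℝ] ℂ)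

@[simp] theorem schwartzConj_apply (φ : 𝓢(ℝ, ℂ)) (x : ℝ) : schwartzConj φ x = conj (φ x) := rfl

theorem schwartzConj_smul (c : ℂ) (φ : 𝓢(ℝ, ℂ)) :
    schwartzConj (c • φ) = conj c • schwartzConj φ := by
  ext x; simp

/-- The operator `|u⟩⟨v|`. A tempered distribution `v` is paired bilinearly with test functions, so
`⟨v|φ⟩` is the conjugate of `v` evaluated at the conjugate of `φ`. -/
def ketBra (u v : 𝓢'(ℝ, ℂ)) : GenOp where
  toFun φ := conj (v (schwartzConj φ)) • u
  map_add' φ χ := by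
    ext χ'
    change conj (v (schwartzConj (φ + χ))) * u χ' =
      conj (v (schwartzConj φ)) * u χ' + conj (v (schwartzConj χ)) * u χ'
    rw [map_add, map_add, map_add, add_mul]
  map_smul' c φ := by simp [schwartzConj_smul, mul_smul]
  cont := by
    have h : Continuous fun φ : 𝓢(ℝ, ℂ) => conj (v (schwartzConj φ)) :=
      Complex.continuous_conj.comp (v.continuous.comp schwartzConj.continuous)
    refine PointwiseConvergenceCLM.continuous_of_continuous_eval fun χ => ?_
    exact h.mul continuous_const

/-- The points `(d n + j) ℓ` of the ideal codeword `j`. -/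
def gkpPoint (d : ℕ) (j : ZMod d) (n : ℤ) : ℝ := (d * n + j.val) * ell d

theorem ell_pos (d : ℕ) [NeZero d] : 0 < ell d := by
  have : (0 : ℝ) < d := by exact_mod_cast Nat.pos_of_neZero d
  unfold ell; positivity

theorem summable_gkpWeight (d : ℕ) [NeZero d] (j : ZMod d) :
    Summable fun n : ℤ => ((1 + ‖gkpPoint d j n‖) ^ 2)⁻¹ := by
  have hd : (0 : ℝ) < d := by exact_mod_cast Nat.pos_of_neZero d
  have hl := ell_pos d
  have h1 : Summable fun n : ℤ => 1 / |(n : ℝ) + j.val / d| ^ (2 : ℝ) :=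
    (Real.summable_one_div_int_add_rpow _ 2).2 (by norm_num)
  refine Summable.of_norm_bounded_eventually (h1.mul_left ((d * ell d) ^ 2)⁻¹) ?_
  have hfin : {n : ℤ | (n : ℝ) + j.val / d = 0}.Finite := by
    refine Set.Subsingleton.finite fun a ha b hb => ?_
    have h : (a : ℝ) = b := by
      simp only [Set.mem_ofPred_eq] at ha hb
      linarith
    exact_mod_cast h
  filter_upwards [hfin.compl_mem_cofinite] with n hn
  have hn' : (n : ℝ) + j.val / d ≠ 0 := hn
  have hpos : 0 < |(n : ℝ) + j.val / d| := abs_pos.2 hn'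
  have e : ‖gkpPoint d j n‖ = d * ell d * |(n : ℝ) + j.val / d| := by
    have : gkpPoint d j n = d * ell d * ((n : ℝ) + j.val / d) := by
      unfold gkpPoint; field_simp
    rw [this, Real.norm_eq_abs, abs_mul, abs_of_pos (by positivity)]
  rw [e, Real.norm_of_nonneg (by positivity), Real.rpow_two, one_div, ← mul_inv, ← mul_pow]
  gcongr
  linarith

theorem gkp_bound (φ : 𝓢(ℝ, ℂ)) (x : ℝ) :
    ‖φ x‖ ≤ ((1 + ‖x‖) ^ 2)⁻¹ *
      (2 ^ 2 * (Finset.Iic (2, 0)).sup (schwartzSeminormFamily ℂ ℝ ℂ) φ) := by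
  have h := one_add_le_sup_seminorm_apply (𝕜 := ℂ) (m := (2, 0)) le_rfl le_rfl φ x
  rw [norm_iteratedFDeriv_zero] at h
  rw [inv_mul_eq_div, le_div_iff₀ (by positivity), mul_comm]
  exact h

theorem summable_gkp (d : ℕ) [NeZero d] (j : ZMod d) (φ : 𝓢(ℝ, ℂ)) :
    Summable fun n : ℤ => φ (gkpPoint d j n) :=
  Summable.of_norm_bounded ((summable_gkpWeight d j).mul_right _) fun _ => gkp_bound φ _

/-- The ideal codeword `|j_GKP⟩ = ℓ^(-1/2) ∑ₙ |(d n + j) ℓ⟩`, where the position ket `|x⟩` is the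
Dirac distribution at `x`. -/
def gkpKet (d : ℕ) [NeZero d] (j : ZMod d) : 𝓢'(ℝ, ℂ) :=
  ContinuousLinearMap.toPointwiseConvergenceCLM _ _ _ _ <|
    mkCLMtoNormedSpace (σ := RingHom.id ℂ)
      (fun φ : 𝓢(ℝ, ℂ) => (1 / Real.sqrt (ell d) : ℂ) * ∑' n : ℤ, φ (gkpPoint d j n))
      (fun φ χ => by
        simp only [add_apply]
        rw [(summable_gkp d j φ).tsum_add (summable_gkp d j χ), mul_add])
      (fun c φ => by
        simp only [smul_apply, smul_eq_mul, RingHom.id_apply]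
        rw [tsum_mul_left]; ring)
      ⟨Finset.Iic (2, 0), ‖(1 / Real.sqrt (ell d) : ℂ)‖ *
          ((∑' n : ℤ, ((1 + ‖gkpPoint d j n‖) ^ 2)⁻¹) * 2 ^ 2), by positivity, fun φ => by
        rw [norm_mul, mul_assoc, mul_assoc]
        gcongr
        rw [← tsum_mul_right]
        exact tsum_of_norm_bounded ((summable_gkpWeight d j).mul_right _).hasSum
          fun _ => gkp_bound φ _⟩

/-- The ideal GKP state `∑_{j,k} ρ_{jk} |j_GKP⟩⟨k_GKP|` that perfectly encodes `ρ`. -/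
def gkpEncode (d : ℕ) [NeZero d] (ρ : Matrix (ZMod d) (ZMod d) ℂ) : GenOp :=
  ∑ j, ∑ k, ρ j k • ketBra (gkpKet d j) (gkpKet d k)

/-! ### The Zak-Gross Wigner function of a non-normalizable state

For functions `g`, `h` with `g 0 = 1`, `∫ h = 1`, the operator
`E u = h_δ * (g (ε ·) u)`, `h_δ = δ⁻¹ h (· / δ)`, tends to the identity as `ε, δ → 0`. It cuts off
large positions and momenta, so that `E ρ E†` is of trace class for every generalized operator `ρ`.
(For Gaussian `g`, `h`, the `E |j_GKP⟩` are the usual finitely squeezed codewords.) The Wigner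
function of `ρ` is the limit of those of the normalized operators `E ρ E† / Tr (E ρ E†)`. -/

/-- Multiplication by `c ≠ 0` of the argument of a test function. -/
def dilate (f : 𝓢(ℝ, ℂ)) {c : ℝ} (hc : c ≠ 0) : 𝓢(ℝ, ℂ) :=
  compCLMOfContinuousLinearEquiv ℂ (ContinuousLinearEquiv.smulLeft (Units.mk0 c hc) : ℝ ≃L[ℝ] ℝ) f

/-- The integral kernel `y ↦ δ⁻¹ h ((x - y) / δ) g (ε y)` of `E`, at a fixed `x`. -/
def regRow (g h : 𝓢(ℝ, ℂ)) {ε δ : ℝ} (hε : 0 < ε) (hδ : 0 < δ) (x : ℝ) : 𝓢(ℝ, ℂ) :=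
  (δ⁻¹ : ℂ) • pairing (ContinuousLinearMap.mul ℂ ℂ)
    (compSubConstCLM ℂ x (dilate h (neg_ne_zero.2 (inv_ne_zero hδ.ne')))) (dilate g hε.ne')

theorem regRow_apply (g h : 𝓢(ℝ, ℂ)) {ε δ : ℝ} (hε : 0 < ε) (hδ : 0 < δ) (x y : ℝ) :
    regRow g h hε hδ x y = (δ : ℂ)⁻¹ * (h ((x - y) / δ) * g (ε * y)) := by
  have e : -δ⁻¹ * (y - x) = (x - y) / δ := by field_simp; ring
  simp [regRow, dilate, Units.smul_def, ← e]

/-- The kernel `⟨x| E ρ E† |x'⟩` of the regularized operator. -/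
def regKernel (g h : 𝓢(ℝ, ℂ)) {ε δ : ℝ} (hε : 0 < ε) (hδ : 0 < δ) (ρ : GenOp) (x x' : ℝ) : ℂ :=
  ρ (schwartzConj (regRow g h hε hδ x')) (regRow g h hε hδ x)

/-- `A` is the integral operator on `L²(ℝ)` with kernel `k`. -/
def IsIntegralOperator (k : ℝ → ℝ → ℂ) (A : Mode →L[ℂ] Mode) : Prop :=
  ∀ ψ : Mode, (A ψ : ℝ → ℂ) =ᵐ[volume] fun x => ∫ y, k x y * ψ y

/-- `W` is the (trace-normalized) Zak-Gross Wigner function of the generalized operator `ρ`: it is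
the limit of the Zak-Gross Wigner functions of `E ρ E† / Tr (E ρ E†)`, for every regularization. -/
def HasZakGross (d : ℕ) (ρ : GenOp) (W : 𝓢'(Phase, ℂ)) : Prop :=
  ∀ g h : 𝓢(ℝ, ℂ), g 0 = 1 → ∫ x, h x = 1 →
    ∃ A : ℝ → ℝ → (Mode →L[ℂ] Mode),
      (∀ (ε δ : ℝ) (hε : 0 < ε) (hδ : 0 < δ),
        IsIntegralOperator (regKernel g h hε hδ ρ) (A ε δ)) ∧
      (∀ᶠ p : ℝ × ℝ in 𝓝[>] 0 ×ˢ 𝓝[>] 0, trace (A p.1 p.2) ≠ 0) ∧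
      ∀ f : 𝓢(Phase, ℂ),
        Tendsto (fun p : ℝ × ℝ => zakGross d ((trace (A p.1 p.2))⁻¹ • A p.1 p.2) f)
          (𝓝[>] 0 ×ˢ 𝓝[>] 0) (𝓝 (W f))

/-- The point `ℓ a` of the lattice `ℓ ℤ²`. -/
def latticePoint (d : ℕ) (a : ℤ × ℤ) : Phase := !₂[ell d * a.1, ell d * a.2]

/-- A distribution that is nonnegative: it is nonnegative on nonnegative test functions. -/
def IsNonneg (W : 𝓢'(Phase, ℂ)) : Prop :=
  ∀ f : 𝓢(Phase, ℂ), (∀ η, 0 ≤ f η) → 0 ≤ W f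

end ZakGross

end

namespace ZakGross

section Qudit

variable {d : ℕ} [NeZero d]

theorem omega_add (k l : ZMod d) : omega d (k + l) = omega d k * omega d l :=
  AddChar.map_add_eq_mul _ _ _

@[simp] theorem omega_zero : omega d 0 = 1 := AddChar.map_zero_eq_one _

theorem omega_pow (k : ZMod d) (n : ℕ) : omega d k ^ n = omega d (n * k) := by
  rw [← nsmul_eq_mul]; exact (AddChar.map_nsmul_eq_pow _ _ _).symm

theorem omega_intCast (k : ℤ) :
    omega d (k : ZMod d) = Complex.exp (2 * Real.pi * Complex.I * k / d) :=
  ZMod.stdAddChar_coe k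

theorem omega_injective : Function.Injective (omega d) := ZMod.injective_stdAddChar

theorem norm_omega (k : ZMod d) : ‖omega d k‖ = 1 := by
  change ‖(ZMod.stdAddChar k : ℂ)‖ = 1
  rw [ZMod.stdAddChar_apply, Circle.norm_coe]

theorem omega_ne_zero (k : ZMod d) : omega d k ≠ 0 :=
  norm_ne_zero_iff.1 (by rw [norm_omega]; exact one_ne_zero)

theorem conj_omega (k : ZMod d) : conj (omega d k) = omega d (-k) := by
  refine mul_left_cancel₀ (omega_ne_zero k) ?_
  rw [← omega_add, add_neg_cancel, omega_zero, Complex.mul_conj, Complex.normSq_eq_norm_sq,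
    norm_omega]
  simp

theorem sum_omega_mul (a : ZMod d) :
    ∑ j : ZMod d, omega d (j * a) = if a = 0 then (d : ℂ) else 0 := by
  have h := AddChar.sum_mulShift a (ZMod.isPrimitive_stdAddChar d)
  simpa [ZMod.card, omega] using h

theorem sum_omega_symp (a : ZMod d × ZMod d) :
    ∑ t : ZMod d × ZMod d, omega d (symp t a) = if a = 0 then (d : ℂ) ^ 2 else 0 := by
  have h : ∀ t : ZMod d × ZMod d,
      omega d (symp t a) = omega d (t.1 * a.2) * omega d (t.2 * -a.1) := fun t => by
    rw [← omega_add]; congr 1; simp only [symp]; ring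
  simp_rw [h, Fintype.sum_prod_type, ← Finset.mul_sum, ← Finset.sum_mul, sum_omega_mul,
    neg_eq_zero, Prod.ext_iff, Prod.fst_zero, Prod.snd_zero]
  split_ifs <;> simp_all [sq]

theorem pauliX_pow_apply (n : ℕ) (k j : ZMod d) :
    (pauliX d ^ n) k j = if k = j + n then 1 else 0 := by
  induction n generalizing k j with
  | zero => simp [Matrix.one_apply]
  | succ n ih =>
    have h : ∀ i, pauliX d i j = if i = j + 1 then 1 else 0 := fun i => rfl
    rw [pow_succ, Matrix.mul_apply]
    simp only [ih, h, mul_ite, mul_one, mul_zero, Finset.sum_ite_eq', Finset.mem_univ, if_true]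
    push_cast
    rw [add_assoc, add_comm (1 : ZMod d)]

theorem weyl_apply (a : ZMod d × ZMod d) (k j : ZMod d) :
    weyl d a k j = if k = j + a.1 then omega d (half d * a.1 * a.2 + a.2 * j) else 0 := by
  rw [weyl, Matrix.smul_apply, pauliZ, Matrix.diagonal_pow, Matrix.mul_diagonal, pauliX_pow_apply,
    ZMod.natCast_zmod_val, Pi.pow_apply, omega_pow, ZMod.natCast_zmod_val, omega_add, smul_eq_mul]
  split_ifs <;> simp

theorem two_mul_half (hd : Odd d) : 2 * half d = 1 := by
  obtain ⟨m, rfl⟩ := hd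
  have h : (2 * m + 1 + 1) / 2 = m + 1 := by omega
  have h0 : ((2 * m + 1 : ℕ) : ZMod (2 * m + 1)) = 0 := ZMod.natCast_self _
  push_cast at h0
  rw [half, h]
  push_cast
  linear_combination h0

@[simp] theorem weyl_zero : weyl d 0 = 1 := by
  ext k j
  simp [weyl_apply, Matrix.one_apply]

theorem weyl_mul (hd : Odd d) (a b : ZMod d × ZMod d) :
    weyl d a * weyl d b = omega d (-(half d * symp a b)) • weyl d (a + b) := by
  ext k j
  have e : k = j + b.1 + a.1 ↔ k = j + (a + b).1 := by
    rw [Prod.fst_add, add_assoc, add_comm b.1]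
  rw [Matrix.mul_apply, Matrix.smul_apply, weyl_apply]
  simp only [weyl_apply, mul_ite, mul_zero, Finset.sum_ite_eq', Finset.mem_univ, if_true,
    smul_eq_mul, ite_mul, zero_mul, e]
  split_ifs
  · rw [← omega_add, ← omega_add]
    congr 1
    simp only [symp, Prod.fst_add, Prod.snd_add]
    linear_combination (-a.2 * b.1) * two_mul_half hd
  · rfl

theorem trace_weyl (a : ZMod d × ZMod d) :
    (weyl d a).trace = if a = 0 then (d : ℂ) else 0 := by
  simp only [Matrix.trace, Matrix.diag_apply, weyl_apply, left_eq_add]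
  by_cases h : a.1 = 0
  · simp only [h, if_true, mul_zero, zero_mul, zero_add, mul_comm a.2, sum_omega_mul,
      Prod.ext_iff, Prod.fst_zero, Prod.snd_zero, true_and]
  · simp [h, Prod.ext_iff]

theorem trace_weyl_mul (a : ZMod d × ZMod d) (ρ : Matrix (ZMod d) (ZMod d) ℂ) :
    (weyl d a * ρ).trace =
      ∑ j, ∑ k, ρ j k * if k = j + a.1 then omega d (half d * a.1 * a.2 + a.2 * j) else 0 := by
  simp only [Matrix.trace, Matrix.diag_apply, Matrix.mul_apply, weyl_apply]
  rw [Finset.sum_comm]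
  simp_rw [mul_comm]

theorem grossWigner_eq_sum (ρ : Matrix (ZMod d) (ZMod d) ℂ) (t : ZMod d × ZMod d) :
    grossWigner d ρ t = (1 / (d : ℂ)) *
      ∑ a : ZMod d × ZMod d, omega d (-symp t a) * (weyl d a * ρ).trace := by
  simp [grossWigner, grossPhasePoint, Finset.sum_mul, Matrix.trace_sum]

theorem trace_weyl_mul_eq_sum_grossWigner (ρ : Matrix (ZMod d) (ZMod d) ℂ)
    (a : ZMod d × ZMod d) :
    (weyl d a * ρ).trace =
      (1 / (d : ℂ)) * ∑ t : ZMod d × ZMod d, omega d (symp t a) * grossWigner d ρ t := by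
  have hd : (d : ℂ) ≠ 0 := NeZero.ne _
  have h : ∀ t b : ZMod d × ZMod d,
      omega d (symp t a) * omega d (-symp t b) = omega d (symp t (a - b)) := fun t b => by
    rw [← omega_add]; congr 1; simp only [symp, Prod.fst_sub, Prod.snd_sub]; ring
  simp_rw [grossWigner_eq_sum, mul_left_comm _ (1 / (d : ℂ)), ← Finset.mul_sum, Finset.mul_sum,
    ← mul_assoc]
  rw [Finset.sum_comm]
  simp_rw [mul_assoc, ← mul_assoc (omega d _), h, ← Finset.mul_sum, ← Finset.sum_mul,
    sum_omega_symp, sub_eq_zero, ite_mul, zero_mul]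
  rw [Finset.sum_ite_eq, if_pos (Finset.mem_univ _)]
  field_simp

/-- A vector fixed by two Pauli operators forces them to commute. -/
theorem symp_eq_zero_of_fixed (hd : Odd d) {ψ : ZMod d → ℂ} (hψ : ψ ≠ 0) {k l : ZMod d}
    {a b : ZMod d × ZMod d} (ha : (omega d k • weyl d a) *ᵥ ψ = ψ)
    (hb : (omega d l • weyl d b) *ᵥ ψ = ψ) : symp a b = 0 := by
  have hab : ((omega d k • weyl d a) * (omega d l • weyl d b)) *ᵥ ψ = ψ := by
    rw [← Matrix.mulVec_mulVec, hb, ha]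
  have hba : ((omega d l • weyl d b) * (omega d k • weyl d a)) *ᵥ ψ = ψ := by
    rw [← Matrix.mulVec_mulVec, ha, hb]
  simp only [Matrix.smul_mul, Matrix.mul_smul, weyl_mul hd, smul_smul, ← omega_add] at hab hba
  have hs : symp b a = -symp a b := by simp only [symp]; ring
  have e : k + (l + -(half d * symp b a)) =
      symp a b + (l + (k + -(half d * symp a b))) := by
    rw [hs]; linear_combination symp a b * two_mul_half hd
  rw [add_comm b a, e, omega_add, ← smul_smul, Matrix.smul_mulVec, hab] at hba
  obtain ⟨i, hi⟩ := Function.ne_iff.1 hψ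
  have h1 : omega d (symp a b) * ψ i = ψ i := congrFun hba i
  have h2 : omega d (symp a b) = 1 := mul_right_cancel₀ hi (by rw [h1, one_mul])
  exact omega_injective (h2.trans omega_zero.symm)

theorem trace_grossPhasePoint_mul_weyl (hd : Odd d) (t b : ZMod d × ZMod d) :
    (grossPhasePoint d t * weyl d b).trace = omega d (symp t b) := by
  have hd0 : (d : ℂ) ≠ 0 := NeZero.ne _
  change grossWigner d (weyl d b) t = _
  rw [grossWigner_eq_sum]
  simp_rw [weyl_mul hd, Matrix.trace_smul, trace_weyl, add_eq_zero_iff_eq_neg, smul_eq_mul, mul_ite,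
    mul_zero]
  have e1 : symp (-b) b = 0 := by simp only [symp, Prod.fst_neg, Prod.snd_neg]; ring
  have e2 : -symp t (-b) = symp t b := by simp only [symp, Prod.fst_neg, Prod.snd_neg]; ring
  rw [Finset.sum_ite_eq' _ (-b), if_pos (Finset.mem_univ _), e1, e2, mul_zero, neg_zero, omega_zero]
  field_simp

theorem conjTranspose_weyl (hd : Odd d) (a : ZMod d × ZMod d) :
    (weyl d a)ᴴ = weyl d (-a) := by
  ext k j
  rw [Matrix.conjTranspose_apply, weyl_apply, weyl_apply, Prod.fst_neg, Prod.snd_neg]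
  by_cases h : j = k + a.1
  · rw [if_pos h, if_pos (by rw [h]; ring), ← starRingEnd_apply, conj_omega]
    congr 1
    rw [h]
    linear_combination (-a.1 * a.2) * two_mul_half hd
  · rw [if_neg h, if_neg (fun h' => h (by rw [h']; ring)), star_zero]

theorem conjTranspose_pauli_mul_self (hd : Odd d) (k : ZMod d) (a : ZMod d × ZMod d) :
    (omega d k • weyl d a)ᴴ * (omega d k • weyl d a) = 1 := by
  have e : symp (-a) a = 0 := by simp only [symp, Prod.fst_neg, Prod.snd_neg]; ring
  rw [Matrix.conjTranspose_smul, conjTranspose_weyl hd, ← starRingEnd_apply, conj_omega,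
    Matrix.smul_mul, Matrix.mul_smul, weyl_mul hd, smul_smul, smul_smul, ← omega_add, ← omega_add, e]
  simp

/-- The projection onto the joint fixed line of a stabilizer group is the average of the group. -/
theorem sum_stabilizer (hd : Odd d) {ψ : ZMod d → ℂ} (h1 : star ψ ⬝ᵥ ψ = 1)
    (S : Subgroup (Matrix (ZMod d) (ZMod d) ℂ)ˣ) [Fintype S]
    (hS : ∀ P ∈ S, ∃ (k : ZMod d) (a : ZMod d × ZMod d),
      (P : Matrix (ZMod d) (ZMod d) ℂ) = omega d k • weyl d a)
    (hfix : ∀ v : ZMod d → ℂ,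
      (∀ P ∈ S, (P : Matrix (ZMod d) (ZMod d) ℂ) *ᵥ v = v) ↔ ∃ c : ℂ, v = c • ψ) :
    ∑ P : S, ((P : (Matrix (ZMod d) (ZMod d) ℂ)ˣ) : Matrix (ZMod d) (ZMod d) ℂ) =
      (Fintype.card S : ℂ) • Matrix.vecMulVec ψ (star ψ) := by
  set Q := ∑ P : S, ((P : (Matrix (ZMod d) (ZMod d) ℂ)ˣ) : Matrix (ZMod d) (ZMod d) ℂ) with hQ
  have hψ : ∀ P ∈ S, (P : Matrix (ZMod d) (ZMod d) ℂ) *ᵥ ψ = ψ :=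
    (hfix ψ).2 ⟨1, (one_smul _ _).symm⟩
  have hψ' : star ψ ᵥ* Q = (Fintype.card S : ℂ) • star ψ := by
    have h : ∀ P : S,
        star ψ ᵥ* ((P : (Matrix (ZMod d) (ZMod d) ℂ)ˣ) : Matrix (ZMod d) (ZMod d) ℂ) = star ψ := by
      rintro ⟨P, hP⟩
      obtain ⟨k, a, e⟩ := hS P hP
      have h3 : (P : Matrix (ZMod d) (ZMod d) ℂ)ᴴ *ᵥ ψ = ψ := by
        conv_lhs => rw [← hψ P hP]
        rw [Matrix.mulVec_mulVec, e, conjTranspose_pauli_mul_self hd, Matrix.one_mulVec]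
      have h4 := congrArg star h3
      rwa [Matrix.star_mulVec, Matrix.conjTranspose_conjTranspose] at h4
    rw [hQ, Matrix.vecMul_sum]
    simp_rw [h]
    rw [Finset.sum_const, Finset.card_univ, Nat.cast_smul_eq_nsmul]
  refine Matrix.ext_of_mulVec_single fun i => ?_
  set v : ZMod d → ℂ := Pi.single i 1
  have hfixQ : ∀ P ∈ S, (P : Matrix (ZMod d) (ZMod d) ℂ) *ᵥ (Q *ᵥ v) = Q *ᵥ v := by
    intro P hP
    rw [Matrix.mulVec_mulVec, hQ, Finset.mul_sum]
    congr 1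
    exact Fintype.sum_equiv (Equiv.mulLeft (⟨P, hP⟩ : S)) _ _ fun R => rfl
  obtain ⟨c, hc⟩ := (hfix _).1 hfixQ
  have h5 : c = (Fintype.card S : ℂ) * (star ψ ⬝ᵥ v) := by
    have := congrArg (star ψ ⬝ᵥ ·) hc
    simp only [Matrix.dotProduct_mulVec, hψ', smul_dotProduct, dotProduct_smul, h1] at this
    simpa using this.symm
  rw [hc, Matrix.smul_mulVec, Matrix.vecMulVec_mulVec, h5]
  ext j
  simp only [Pi.smul_apply, smul_eq_mul, MulOpposite.smul_eq_mul_unop, MulOpposite.unop_op]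
  ring

theorem grossWigner_nonneg_of_isStabilizerState (hd : Odd d) {ρ : Matrix (ZMod d) (ZMod d) ℂ}
    (hρ : IsStabilizerState d ρ) (t : ZMod d × ZMod d) : 0 ≤ grossWigner d ρ t := by
  obtain ⟨ψ, h1, rfl, S, hS, hfix⟩ := hρ
  have hψ0 : ψ ≠ 0 := by rintro rfl; simp at h1
  have hψ : ∀ P ∈ S, (P : Matrix (ZMod d) (ZMod d) ℂ) *ᵥ ψ = ψ :=
    (hfix ψ).2 ⟨1, (one_smul _ _).symm⟩
  have : Finite S := by
    let p : ZMod d × ZMod d × ZMod d → Matrix (ZMod d) (ZMod d) ℂ := fun x =>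
      omega d x.1 • weyl d x.2
    refine Finite.of_injective (β := Set.range p)
      (fun P => ⟨(P : (Matrix (ZMod d) (ZMod d) ℂ)ˣ), ?_⟩) ?_
    · obtain ⟨k, a, e⟩ := hS P P.2
      exact ⟨(k, a), e.symm⟩
    · intro P R h
      exact Subtype.ext (Units.ext (congrArg Subtype.val h))
  let _ : Fintype S := Fintype.ofFinite S
  let χ : S → ℂ := fun P => (grossPhasePoint d t *
    ((P : (Matrix (ZMod d) (ZMod d) ℂ)ˣ) : Matrix (ZMod d) (ZMod d) ℂ)).trace
  have hχ : ∀ P R : S, χ (P * R) = χ P * χ R := by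
    rintro ⟨P, hP⟩ ⟨R, hR⟩
    obtain ⟨k, a, eP⟩ := hS P hP
    obtain ⟨l, b, eR⟩ := hS R hR
    have hab : symp a b = 0 := symp_eq_zero_of_fixed hd hψ0 (by rw [← eP]; exact hψ P hP)
      (by rw [← eR]; exact hψ R hR)
    have e : symp t (a + b) = symp t a + symp t b := by
      simp only [symp, Prod.fst_add, Prod.snd_add]; ring
    simp only [χ, Subgroup.coe_mul, Units.val_mul, eP, eR, Matrix.smul_mul, Matrix.mul_smul,
      weyl_mul hd, hab, Matrix.trace_smul, trace_grossPhasePoint_mul_weyl hd, smul_eq_mul, e,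
      omega_add, mul_zero, neg_zero, omega_zero, one_smul]
    ring
  have hcard : (0 : ℂ) < Fintype.card S := by exact_mod_cast Fintype.card_pos
  have hsum : (Fintype.card S : ℂ) * grossWigner d (Matrix.vecMulVec ψ (star ψ)) t = ∑ P, χ P := by
    rw [grossWigner, ← smul_eq_mul, ← Matrix.trace_smul, ← Matrix.mul_smul,
      ← sum_stabilizer hd h1 S hS hfix, Finset.mul_sum, Matrix.trace_sum]
  have hnn : 0 ≤ ∑ P, χ P := by
    have hinv : ∀ P, χ P * ∑ R, χ R = ∑ R, χ R := fun P => by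
      rw [Finset.mul_sum]
      simp_rw [← hχ]
      exact Fintype.sum_equiv (Equiv.mulLeft P) _ _ fun R => rfl
    by_cases h0 : ∑ R, χ R = 0
    · rw [h0]
    · have : ∀ P, χ P = 1 := fun P => mul_right_cancel₀ h0 (by rw [hinv, one_mul])
      simp [this]
  rw [← hsum] at hnn
  exact le_of_mul_le_mul_left (by rwa [mul_zero]) hcard

end Qudit

section Decay

theorem decay_bound {E : Type*} [NormedAddCommGroup E] [NormedSpace ℝ E] (φ : 𝓢(E, ℂ))
    (n : ℕ) (x : E) : ‖φ x‖ ≤ (2 ^ (2 * n) *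
      (Finset.Iic (2 * n, 0)).sup (schwartzSeminormFamily ℂ E ℂ) φ) * ((1 + ‖x‖ ^ 2)⁻¹) ^ n := by
  have h := one_add_le_sup_seminorm_apply (𝕜 := ℂ) (m := (2 * n, 0)) le_rfl le_rfl φ x
  rw [norm_iteratedFDeriv_zero] at h
  rw [inv_pow, ← div_eq_mul_inv, le_div_iff₀ (by positivity), mul_comm]
  refine le_trans ?_ h
  rw [pow_mul]
  gcongr
  nlinarith [norm_nonneg x]

theorem exists_decay_bound {E : Type*} [NormedAddCommGroup E] [NormedSpace ℝ E] (φ : 𝓢(E, ℂ))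
    (n : ℕ) : ∃ C : ℝ, 0 ≤ C ∧ ∀ x, ‖φ x‖ ≤ C * ((1 + ‖x‖ ^ 2)⁻¹) ^ n :=
  ⟨_, by positivity, decay_bound φ n⟩

theorem inv_one_add_norm_sq_le (x y : ℝ) :
    ((1 + ‖(!₂[x, y] : Phase)‖ ^ 2)⁻¹) ^ 2 ≤ (1 + x ^ 2)⁻¹ * (1 + y ^ 2)⁻¹ := by
  have e : ‖(!₂[x, y] : Phase)‖ ^ 2 = x ^ 2 + y ^ 2 := by
    simp [EuclideanSpace.norm_sq_eq, Fin.sum_univ_two]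
  rw [e, sq, ← mul_inv, ← mul_inv]
  gcongr
  · nlinarith [sq_nonneg y]
  · nlinarith [sq_nonneg x]

theorem exists_decay_bound_real (φ : 𝓢(ℝ, ℂ)) (n : ℕ) :
    ∃ C : ℝ, 0 ≤ C ∧ ∀ x, ‖φ x‖ ≤ C * ((1 + x ^ 2)⁻¹) ^ n := by
  simpa [Real.norm_eq_abs, sq_abs] using exists_decay_bound φ n

theorem exists_decay_bound_phase (f : 𝓢(Phase, ℂ)) :
    ∃ C : ℝ, 0 ≤ C ∧ ∀ x y : ℝ, ‖f !₂[x, y]‖ ≤ C * ((1 + x ^ 2)⁻¹ * (1 + y ^ 2)⁻¹) := by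
  obtain ⟨C, hC, h⟩ := exists_decay_bound f 2
  exact ⟨C, hC, fun x y => (h _).trans (mul_le_mul_of_nonneg_left (inv_one_add_norm_sq_le x y) hC)⟩

theorem summable_inv_one_add_mul_sq {c : ℝ} (hc : c ≠ 0) :
    Summable fun n : ℤ => (1 + (c * n) ^ 2)⁻¹ := by
  refine Summable.of_norm_bounded_eventually
    (((Real.summable_one_div_int_pow (p := 2)).2 one_lt_two).mul_left (c ^ 2)⁻¹) ?_
  filter_upwards [(Set.finite_singleton (0 : ℤ)).compl_mem_cofinite] with n hn
  have hn' : (n : ℝ) ≠ 0 := by exact_mod_cast hn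
  rw [Real.norm_of_nonneg (by positivity), one_div, ← mul_inv, ← mul_pow]
  gcongr
  linarith

theorem summable_inv_one_add_int_sq : Summable fun n : ℤ => (1 + (n : ℝ) ^ 2)⁻¹ := by
  simpa using summable_inv_one_add_mul_sq one_ne_zero

theorem summable_norm_lattice (f : 𝓢(Phase, ℂ)) {c c' : ℝ} (hc : c ≠ 0) (hc' : c' ≠ 0) :
    Summable fun a : ℤ × ℤ => ‖f !₂[c * a.1, c' * a.2]‖ := by
  obtain ⟨C, -, h⟩ := exists_decay_bound_phase f
  refine Summable.of_nonneg_of_le (fun _ => norm_nonneg _) (fun a => h _ _) (Summable.mul_left C ?_)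
  exact (summable_inv_one_add_mul_sq hc).mul_of_nonneg (summable_inv_one_add_mul_sq hc')
    (fun _ => by positivity) fun _ => by positivity

theorem inv_one_add_sq_isBigO :
    (fun x : ℝ => (1 + x ^ 2)⁻¹) =O[cocompact ℝ] fun x : ℝ => |x| ^ (-2 : ℝ) := by
  refine Asymptotics.IsBigO.of_bound 1 ?_
  filter_upwards [(Set.finite_singleton (0 : ℝ)).isCompact.compl_mem_cocompact] with x hx
  have hx' : x ≠ 0 := hx
  rw [Real.norm_of_nonneg (by positivity), Real.norm_of_nonneg (by positivity), one_mul,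
    Real.rpow_neg (abs_nonneg _), Real.rpow_two, sq_abs]
  gcongr
  linarith

end Decay

section Poisson

open scoped FourierTransform

theorem integral_phase {E : Type*} [NormedAddCommGroup E] [NormedSpace ℝ E] (F : Phase → E)
    (hF : Integrable F) : ∫ η, F η = ∫ y : ℝ, ∫ x : ℝ, F !₂[x, y] := by
  have e1 := (PiLp.volume_preserving_toLp (Fin 2)).integral_comp
    (MeasurableEquiv.toLp 2 (Fin 2 → ℝ)).measurableEmbedding F
  have e2 := (volume_preserving_finTwoArrow ℝ).symm.integral_comp
    (MeasurableEquiv.finTwoArrow (α := ℝ)).symm.measurableEmbedding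
    (fun v : Fin 2 → ℝ => F (WithLp.toLp 2 v))
  have hF1 := (PiLp.volume_preserving_toLp (Fin 2)).integrable_comp_emb
    (MeasurableEquiv.toLp 2 (Fin 2 → ℝ)).measurableEmbedding (g := F)
  have hF2 := (volume_preserving_finTwoArrow ℝ).symm.integrable_comp_emb
    (MeasurableEquiv.finTwoArrow (α := ℝ)).symm.measurableEmbedding
    (g := fun v : Fin 2 → ℝ => F (WithLp.toLp 2 v))
  have hF3 : Integrable (fun p : ℝ × ℝ => F !₂[p.1, p.2]) (volume.prod volume) :=
    hF2.2 (hF1.2 hF)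
  rw [← e1, ← e2]
  exact integral_prod_symm _ hF3

/-- **Poisson summation** on `ℤ² ⊆ ℝ²` for Schwartz functions. -/
theorem tsum_fourier_phase (f : 𝓢(Phase, ℂ)) :
    ∑' a : ℤ × ℤ, 𝓕 f !₂[(a.1 : ℝ), (a.2 : ℝ)] = ∑' b : ℤ × ℤ, f !₂[(b.1 : ℝ), (b.2 : ℝ)] := by
  obtain ⟨C, hC, hf⟩ := exists_decay_bound_phase f
  have hcont : Continuous fun p : ℝ × ℝ => f !₂[p.1, p.2] := f.continuous.comp (by fun_prop)
  have hfS : Summable fun a : ℤ × ℤ => f !₂[(a.1 : ℝ), (a.2 : ℝ)] := by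
    simpa using (summable_norm_lattice f one_ne_zero one_ne_zero).of_norm
  have hFS : Summable fun a : ℤ × ℤ => 𝓕 f !₂[(a.1 : ℝ), (a.2 : ℝ)] := by
    simpa using (summable_norm_lattice (𝓕 f) one_ne_zero one_ne_zero).of_norm
  let G : ℝ → ℝ → ℂ := fun m y => 𝓕 (fun x : ℝ => f !₂[x, y]) m
  let H : ℝ → ℂ := fun x => ∑' n : ℤ, f !₂[x, (n : ℝ)]
  have hGeq : ∀ m y, G m y = ∫ x : ℝ, Complex.exp (↑(-2 * Real.pi * x * m) * Complex.I) •
      f !₂[x, y] := fun m y => Real.fourier_real_eq_integral_exp_smul _ _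
  have hle1 : ∀ x : ℝ, (1 + x ^ 2)⁻¹ ≤ 1 := fun x => inv_le_one_of_one_le₀ (by nlinarith)
  have hGint : ∀ m y, Integrable fun x : ℝ => Complex.exp (↑(-2 * Real.pi * x * m) * Complex.I) •
      f !₂[x, y] := fun m y => by
    refine (integrable_inv_one_add_sq.const_mul C).mono'
      (Continuous.aestronglyMeasurable (by
        exact (by fun_prop : Continuous fun x : ℝ =>
          Complex.exp (↑(-2 * Real.pi * x * m) * Complex.I)).smul
            (f.continuous.comp (by fun_prop)))) (.of_forall fun x => ?_)
    rw [norm_smul, Complex.norm_exp_ofReal_mul_I, one_mul]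
    refine (hf x y).trans ?_
    have := hle1 y
    gcongr
    exact mul_le_of_le_one_right (by positivity) this
  have hGbound : ∀ m y, ‖G m y‖ ≤ (C * Real.pi) * (1 + y ^ 2)⁻¹ := fun m y => by
    rw [hGeq]
    refine (norm_integral_le_of_norm_le (integrable_inv_one_add_sq.const_mul (C * (1 + y ^ 2)⁻¹))
      (.of_forall fun x => ?_)).trans ?_
    · rw [norm_smul, Complex.norm_exp_ofReal_mul_I, one_mul]
      exact (hf x y).trans (le_of_eq (by ring))
    · rw [integral_const_mul, integral_univ_inv_one_add_sq]
      exact le_of_eq (by ring)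
  have hGcont : ∀ m, Continuous (G m) := fun m => by
    simp_rw [funext (hGeq m)]
    refine continuous_of_dominated (bound := fun x => C * (1 + x ^ 2)⁻¹)
      (fun y => (hGint m y).aestronglyMeasurable) (fun y => .of_forall fun x => ?_)
      (integrable_inv_one_add_sq.const_mul C) (.of_forall fun x => ?_)
    · rw [norm_smul, Complex.norm_exp_ofReal_mul_I, one_mul]
      refine (hf x y).trans ?_
      have := hle1 y
      gcongr
      exact mul_le_of_le_one_right (by positivity) this
    · have h : Continuous fun y : ℝ => f !₂[x, y] :=
        hcont.comp (by fun_prop : Continuous fun y : ℝ => (x, y))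
      exact (continuous_const.mul h :
        Continuous fun y : ℝ => Complex.exp (↑(-2 * Real.pi * x * m) * Complex.I) * f !₂[x, y])
  have hGF : ∀ m n : ℝ, 𝓕 (G m) n = 𝓕 f !₂[m, n] := fun m n => by
    have e : ∀ η : Phase, Complex.exp (↑(-2 * Real.pi * inner ℝ η !₂[m, n]) * Complex.I) • f η =
        Complex.exp (↑(-2 * Real.pi * η 1 * n) * Complex.I) •
          Complex.exp (↑(-2 * Real.pi * η 0 * m) * Complex.I) • f η := fun η => by
      rw [smul_smul, ← Complex.exp_add, ← add_mul, ← Complex.ofReal_add]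
      simp only [PiLp.inner_apply, Fin.sum_univ_two, RCLike.inner_apply, conj_trivial]
      simp only [Matrix.cons_val_zero, Matrix.cons_val_one]
      congr 4
      ring
    rw [SchwartzMap.fourier_coe, Real.fourier_real_eq_integral_exp_smul, Real.fourier_eq',
      integral_phase _ ?_]
    · simp_rw [e, hGeq, ← integral_smul]
      rfl
    · refine f.integrable.norm.mono' (Continuous.aestronglyMeasurable (by fun_prop))
        (.of_forall fun η => ?_)
      rw [norm_smul, Complex.norm_exp_ofReal_mul_I, one_mul]
  have hGP : ∀ m : ℝ, ∑' n : ℤ, G m n = ∑' n : ℤ, 𝓕 f !₂[m, (n : ℝ)] := fun m => by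
    have hO : (G m) =O[cocompact ℝ] fun x : ℝ => |x| ^ (-2 : ℝ) :=
      (Asymptotics.IsBigO.of_bound (C * Real.pi) (.of_forall fun y => by
        rw [Real.norm_of_nonneg (by positivity)]; exact hGbound m y)).trans inv_one_add_sq_isBigO
    have hs : Summable fun n : ℤ => 𝓕 (G m) n := by
      obtain ⟨C', hC', hF⟩ := exists_decay_bound_phase (𝓕 f)
      simp_rw [hGF]
      refine Summable.of_norm_bounded (summable_inv_one_add_int_sq.mul_left
        (C' * (1 + m ^ 2)⁻¹)) fun n => (hF m n).trans (le_of_eq (by ring))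
    have := Real.tsum_eq_tsum_fourier_of_rpow_decay_of_summable (hGcont m) one_lt_two hO hs 0
    simpa [hGF] using this
  have hHb : ∀ x, ‖H x‖ ≤ (C * ∑' n : ℤ, (1 + (n : ℝ) ^ 2)⁻¹) * (1 + x ^ 2)⁻¹ := fun x => by
    have h1 := (summable_inv_one_add_int_sq.mul_left (C * (1 + x ^ 2)⁻¹)).hasSum
    refine (tsum_of_norm_bounded h1 fun n => (hf x n).trans (le_of_eq (by ring))).trans ?_
    rw [tsum_mul_left]
    exact le_of_eq (by ring)
  have hHcont : Continuous H := by
    refine continuous_tsum (fun n => f.continuous.comp (by fun_prop))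
      (summable_inv_one_add_int_sq.mul_left C) fun n x => (hf x n).trans ?_
    have := hle1 x
    gcongr
    exact mul_le_of_le_one_left (by positivity) this
  have hHF : ∀ m : ℝ, 𝓕 H m = ∑' n : ℤ, G m n := fun m => by
    rw [Real.fourier_real_eq_integral_exp_smul]
    simp_rw [hGeq]
    refine ((hasSum_integral_of_summable_integral_norm (fun n : ℤ => hGint m n) ?_).tsum_eq.trans
      ?_).symm
    · refine Summable.of_nonneg_of_le (fun n => integral_nonneg fun x => norm_nonneg _)
        (fun n => ?_) (summable_inv_one_add_int_sq.mul_left (C * Real.pi))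
      calc ∫ x : ℝ, ‖Complex.exp (↑(-2 * Real.pi * x * m) * Complex.I) • f !₂[x, (n : ℝ)]‖
          ≤ ∫ x : ℝ, C * (1 + (n : ℝ) ^ 2)⁻¹ * (1 + x ^ 2)⁻¹ := by
            refine integral_mono (hGint m n).norm (integrable_inv_one_add_sq.const_mul _)
              fun x => ?_
            change ‖_ • _‖ ≤ _
            rw [norm_smul, Complex.norm_exp_ofReal_mul_I, one_mul]
            exact (hf x n).trans (le_of_eq (by ring))
        _ = _ := by rw [integral_const_mul, integral_univ_inv_one_add_sq]; ring
    · refine integral_congr_ae (.of_forall fun x => ?_)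
      exact tsum_const_smul'' _
  have hO : H =O[cocompact ℝ] fun x : ℝ => |x| ^ (-2 : ℝ) :=
    (Asymptotics.IsBigO.of_bound _ (.of_forall fun y => by
      rw [Real.norm_of_nonneg (by positivity)]; exact hHb y)).trans inv_one_add_sq_isBigO
  have hP := Real.tsum_eq_tsum_fourier_of_rpow_decay_of_summable hHcont one_lt_two hO
    (by simp_rw [hHF, hGP]; exact hFS.prod) 0
  simp only [zero_add, QuotientAddGroup.mk_zero, fourier_eval_zero, mul_one, hHF, hGP, H] at hP
  rw [hFS.tsum_prod, hfS.tsum_prod]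
  exact hP.symm

/-- Poisson summation for a shifted and scaled lattice. -/
theorem tsum_affine_lattice (f : 𝓢(Phase, ℂ)) {L : ℝ} (hL : L ≠ 0) (x₀ : Phase) :
    ∑' b : ℤ × ℤ, f (L • !₂[(b.1 : ℝ), (b.2 : ℝ)] + x₀) =
      ∑' a : ℤ × ℤ, ((L ^ 2)⁻¹ : ℂ) *
        (Complex.exp (↑(2 * Real.pi * inner ℝ x₀ (L⁻¹ • !₂[(a.1 : ℝ), (a.2 : ℝ)])) * Complex.I) *
          𝓕 f (L⁻¹ • !₂[(a.1 : ℝ), (a.2 : ℝ)])) := by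
  let g : 𝓢(Phase, ℂ) := compCLMOfContinuousLinearEquiv ℂ
    (ContinuousLinearEquiv.smulLeft (Units.mk0 L hL) : Phase ≃L[ℝ] Phase)
      (compSubConstCLM ℂ (-x₀) f)
  have hg : ∀ η, g η = f (L • η + x₀) := fun η => by
    simp [g, Units.smul_def]
  have hF : ∀ w, 𝓕 g w = ((L ^ 2)⁻¹ : ℂ) *
      (Complex.exp (↑(2 * Real.pi * inner ℝ x₀ (L⁻¹ • w)) * Complex.I) * 𝓕 f (L⁻¹ • w)) := by
    intro w
    have e : ∀ η : Phase, Complex.exp (↑(-2 * Real.pi * inner ℝ η w) * Complex.I) • g η =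
        (fun ζ : Phase => Complex.exp (↑(2 * Real.pi * inner ℝ x₀ (L⁻¹ • w)) * Complex.I) •
          Complex.exp (↑(-2 * Real.pi * inner ℝ ζ (L⁻¹ • w)) * Complex.I) • f ζ)
            (L • η + x₀) := fun η => by
      simp only [hg, smul_smul, ← Complex.exp_add, ← add_mul, ← Complex.ofReal_add]
      congr 4
      simp only [inner_add_left, inner_smul_left, inner_smul_right, conj_trivial]
      field_simp
      ring
    rw [SchwartzMap.fourier_coe, SchwartzMap.fourier_coe, Real.fourier_eq', Real.fourier_eq']
    simp_rw [e]
    rw [Measure.integral_comp_smul volume (fun η => (fun ζ : Phase =>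
        Complex.exp (↑(2 * Real.pi * inner ℝ x₀ (L⁻¹ • w)) * Complex.I) •
          Complex.exp (↑(-2 * Real.pi * inner ℝ ζ (L⁻¹ • w)) * Complex.I) • f ζ) (η + x₀)) L,
      integral_add_right_eq_self (fun ζ : Phase =>
        Complex.exp (↑(2 * Real.pi * inner ℝ x₀ (L⁻¹ • w)) * Complex.I) •
          Complex.exp (↑(-2 * Real.pi * inner ℝ ζ (L⁻¹ • w)) * Complex.I) • f ζ), integral_smul]
    simp [abs_of_nonneg, sq_nonneg]
  have h := tsum_fourier_phase g
  simp_rw [hg, hF] at h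
  exact h.symm

end Poisson

section RiemannSum

theorem map_floor_volume :
    (volume : Measure ℝ).map (Int.floor : ℝ → ℤ) = Measure.count := by
  refine Measure.ext_of_singleton fun n => ?_
  rw [Measure.map_apply Int.measurable_floor (measurableSet_singleton n), Int.preimage_floor_singleton,
    Real.volume_Ico, Measure.count_singleton]
  simp

theorem integral_floor {F : ℤ → ℂ} (hF : Summable F) : ∫ x : ℝ, F ⌊x⌋ = ∑' n, F n := by
  rw [← integral_map (φ := (Int.floor : ℝ → ℤ)) (f := F) Int.measurable_floor.aemeasurable
    (by rw [map_floor_volume]; exact (measurable_of_countable F).aestronglyMeasurable),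
    map_floor_volume, integral_countable (integrable_count_iff.2 hF.norm)]
  simp

theorem summable_inv_one_add_affine_sq {c : ℝ} (hc : c ≠ 0) (b : ℝ) :
    Summable fun n : ℤ => (1 + (c * n + b) ^ 2)⁻¹ := by
  refine Summable.of_nonneg_of_le (fun n => by positivity) (fun n => ?_)
    ((summable_inv_one_add_mul_sq hc).mul_left (2 + 2 * b ^ 2))
  rw [← div_eq_mul_inv, inv_eq_one_div, div_le_div_iff₀ (by positivity) (by positivity)]
  nlinarith [sq_nonneg (c * n + 2 * b), mul_nonneg (sq_nonneg b) (sq_nonneg (c * n + b))]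

theorem tendsto_riemannSum {u v : ℝ → ℂ} (hu : Continuous u) (hv : Continuous v) {Cu Cv : ℝ}
    (hCu : ∀ x, ‖u x‖ ≤ Cu) (hCv : ∀ x, ‖v x‖ ≤ Cv * (1 + x ^ 2)⁻¹) {s : ℝ} (hs : 0 < s)
    (α β : ℝ) :
    Tendsto (fun ε : ℝ => (ε : ℂ) * ∑' n : ℤ, u (ε * (s * n + α)) * v (ε * (s * n + β)))
      (𝓝[>] 0) (𝓝 ((s : ℂ)⁻¹ * ∫ x, u x * v x)) := by
  have hCu0 : 0 ≤ Cu := (norm_nonneg _).trans (hCu 0)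
  have hCv0 : 0 ≤ Cv := by simpa using (norm_nonneg _).trans (hCv 0)
  have hsum : ∀ ε : ℝ, 0 < ε →
      Summable fun n : ℤ => u (ε * (s * n + α)) * v (ε * (s * n + β)) := by
    intro ε hε
    refine Summable.of_norm_bounded (((summable_inv_one_add_affine_sq (mul_pos hε hs).ne'
      (ε * β)).mul_left Cv).mul_left Cu) fun n => ?_
    rw [norm_mul]
    refine mul_le_mul (hCu _) ((hCv _).trans_eq ?_) (norm_nonneg _) hCu0
    congr 4
    ring
  let r : ℝ → ℝ → ℝ := fun ε x => ε * (s * ⌊(ε * s)⁻¹ * x⌋)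
  have hr : ∀ ε : ℝ, 0 < ε → ∀ x, |r ε x - x| ≤ ε * s := by
    intro ε hε x
    have hes : 0 < ε * s := by positivity
    have h1 := Int.floor_le ((ε * s)⁻¹ * x)
    have h2 := Int.lt_floor_add_one ((ε * s)⁻¹ * x)
    have h3 : ε * s * ((ε * s)⁻¹ * x) = x := by field_simp
    have h4 := mul_le_mul_of_nonneg_left h1 hes.le
    have h5 := mul_lt_mul_of_pos_left h2 hes
    rw [abs_le]
    constructor <;> simp only [r] <;> nlinarith
  have hint : ∀ ε : ℝ, 0 < ε →
      (ε : ℂ) * ∑' n : ℤ, u (ε * (s * n + α)) * v (ε * (s * n + β)) =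
        (s : ℂ)⁻¹ * ∫ x, u (r ε x + ε * α) * v (r ε x + ε * β) := by
    intro ε hε
    have hes : 0 < ε * s := by positivity
    have h := Measure.integral_comp_mul_left
      (fun y : ℝ => u (ε * (s * ⌊y⌋ + α)) * v (ε * (s * ⌊y⌋ + β))) (ε * s)⁻¹
    rw [integral_floor (F := fun n : ℤ => u (ε * (s * n + α)) * v (ε * (s * n + β)))
      (hsum ε hε), inv_inv, abs_of_pos hes] at h
    have e : ∀ x, u (r ε x + ε * α) * v (r ε x + ε * β) =
        u (ε * (s * ⌊(ε * s)⁻¹ * x⌋ + α)) * v (ε * (s * ⌊(ε * s)⁻¹ * x⌋ + β)) := fun x => by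
      simp only [r, mul_add]
    simp_rw [e]
    rw [h, Complex.real_smul]
    push_cast
    have : (s : ℂ) ≠ 0 := by exact_mod_cast hs.ne'
    field_simp
  have hr0 : ∀ x γ : ℝ, Tendsto (fun ε => r ε x + ε * γ) (𝓝[>] 0) (𝓝 x) := by
    intro x γ
    have h0 : Tendsto (fun ε : ℝ => ε) (𝓝[>] 0) (𝓝 0) := nhdsWithin_le_nhds
    have h1 : Tendsto (fun ε => r ε x - x) (𝓝[>] 0) (𝓝 0) := by
      refine squeeze_zero_norm' (a := fun ε => ε * s) ?_ (by simpa using h0.mul_const s)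
      filter_upwards [self_mem_nhdsWithin] with ε hε using hr ε hε x
    have h2 := (h1.add_const x).add (h0.mul_const γ)
    simpa using h2
  have hlim : Tendsto (fun ε => ∫ x, u (r ε x + ε * α) * v (r ε x + ε * β)) (𝓝[>] 0)
      (𝓝 (∫ x, u x * v x)) := by
    refine tendsto_integral_filter_of_dominated_convergence
      (fun x => Cu * (Cv * (3 * (1 + x ^ 2)⁻¹))) (.of_forall fun ε => ?_) ?_
      (((integrable_inv_one_add_sq.const_mul 3).const_mul Cv).const_mul Cu)
      (.of_forall fun x => ((hu.tendsto x).comp (hr0 x α)).mul ((hv.tendsto x).comp (hr0 x β)))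
    · have hm : Measurable (r ε) := by
        have : Measurable fun x : ℝ => ((⌊(ε * s)⁻¹ * x⌋ : ℤ) : ℝ) :=
          (measurable_of_countable (fun n : ℤ => (n : ℝ))).comp
            (Int.measurable_floor.comp (measurable_const_mul _))
        exact (this.const_mul _).const_mul _
      exact ((hu.measurable.comp (hm.add_const _)).mul
        (hv.measurable.comp (hm.add_const _))).aestronglyMeasurable
    · have hε1 : ∀ᶠ ε : ℝ in 𝓝[>] 0, ε * (s + |β|) < 1 := by
        have h0 : Tendsto (fun ε : ℝ => ε * (s + |β|)) (𝓝[>] 0) (𝓝 (0 * (s + |β|))) :=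
          Tendsto.mul_const _ nhdsWithin_le_nhds
        rw [zero_mul] at h0
        exact h0.eventually_lt_const one_pos
      filter_upwards [hε1, self_mem_nhdsWithin] with ε h1 hε
      refine .of_forall fun x => ?_
      rw [norm_mul]
      refine mul_le_mul (hCu _) ((hCv _).trans ?_) (norm_nonneg _) hCu0
      gcongr
      have hy : |r ε x + ε * β - x| ≤ 1 := by
        have : r ε x + ε * β - x = (r ε x - x) + ε * β := by ring
        rw [this]
        refine (abs_add_le _ _).trans ?_
        rw [abs_mul, abs_of_pos (Set.mem_Ioi.1 hε)]
        nlinarith [hr ε hε x]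
      rw [← div_eq_mul_inv, inv_eq_one_div, div_le_div_iff₀ (by positivity) (by positivity)]
      nlinarith [abs_le.1 hy, sq_nonneg (r ε x + ε * β + (r ε x + ε * β - x)),
        sq_abs (r ε x + ε * β - x), abs_nonneg (r ε x + ε * β - x)]
  refine (hlim.const_mul _).congr' ?_
  filter_upwards [self_mem_nhdsWithin] with ε hε using (hint ε hε).symm

end RiemannSum

section Overlap

/-- The overlap of a wave packet with a displaced copy, rescaled by its width `δ`. -/
noncomputable def overlap (h : 𝓢(ℝ, ℂ)) (c δ r : ℝ) : ℂ :=
  ∫ s, conj (h s) * (Complex.exp (Complex.I * c * (δ * s - r : ℝ)) * h (s - r / δ))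

theorem norm_exp_I_mul_mul (c x : ℝ) : ‖Complex.exp (Complex.I * c * x)‖ = 1 := by
  rw [Complex.norm_exp]; simp

theorem exists_overlap_bound (h : 𝓢(ℝ, ℂ)) :
    ∃ C : ℝ, 0 ≤ C ∧ ∀ c δ r : ℝ, ‖overlap h c δ r‖ ≤ C * (1 + (r / δ) ^ 2)⁻¹ := by
  obtain ⟨C, hC, hb⟩ := exists_decay_bound_real h 2
  refine ⟨2 * C * C * Real.pi, by positivity, fun c δ r => ?_⟩
  set R := r / δ
  refine (norm_integral_le_of_norm_le
    (integrable_inv_one_add_sq.const_mul (2 * C * C * (1 + R ^ 2)⁻¹)) (.of_forall fun s => ?_)).trans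
      ?_
  · rw [norm_mul, norm_mul, norm_exp_I_mul_mul, one_mul, RCLike.norm_conj]
    refine (mul_le_mul (hb s) (hb (s - R)) (norm_nonneg _) (by positivity)).trans ?_
    have h1 : ((1 + (s - R) ^ 2)⁻¹) ^ 2 ≤ (1 + (s - R) ^ 2)⁻¹ :=
      pow_le_of_le_one (by positivity) (inv_le_one_of_one_le₀ (by nlinarith [sq_nonneg (s - R)]))
        two_ne_zero
    have h2 : (1 + s ^ 2)⁻¹ * (1 + (s - R) ^ 2)⁻¹ ≤ 2 * (1 + R ^ 2)⁻¹ := by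
      rw [← mul_inv, ← div_eq_mul_inv, inv_eq_one_div,
        div_le_div_iff₀ (by positivity) (by positivity)]
      nlinarith [sq_nonneg (2 * s - R), mul_nonneg (sq_nonneg s) (sq_nonneg (s - R))]
    calc C * ((1 + s ^ 2)⁻¹) ^ 2 * (C * ((1 + (s - R) ^ 2)⁻¹) ^ 2)
        ≤ C * ((1 + s ^ 2)⁻¹) ^ 2 * (C * (1 + (s - R) ^ 2)⁻¹) := by gcongr
      _ = C * C * (1 + s ^ 2)⁻¹ * ((1 + s ^ 2)⁻¹ * (1 + (s - R) ^ 2)⁻¹) := by ring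
      _ ≤ C * C * (1 + s ^ 2)⁻¹ * (2 * (1 + R ^ 2)⁻¹) := by gcongr
      _ = _ := by ring
  · rw [integral_const_mul, integral_univ_inv_one_add_sq]
    exact le_of_eq (by ring)

theorem tendsto_overlap (h : 𝓢(ℝ, ℂ)) (c r : ℝ) :
    Tendsto (fun δ => overlap h c δ r) (𝓝[>] 0)
      (𝓝 (if r = 0 then ∫ s, conj (h s) * h s else 0)) := by
  have h0 : Tendsto (fun δ : ℝ => δ) (𝓝[>] 0) (𝓝 0) := nhdsWithin_le_nhds
  split_ifs with hr
  · subst hr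
    obtain ⟨C, hC, hb⟩ := exists_decay_bound_real h 1
    simp only [pow_one] at hb
    unfold overlap
    simp only [zero_div, sub_zero]
    refine tendsto_integral_filter_of_dominated_convergence (fun s => C * C * (1 + s ^ 2)⁻¹)
      (.of_forall fun δ => Continuous.aestronglyMeasurable ?_) (.of_forall fun δ => .of_forall fun s => ?_)
      (integrable_inv_one_add_sq.const_mul _) (.of_forall fun s => ?_)
    · exact (Complex.continuous_conj.comp h.continuous).mul (Continuous.mul (by fun_prop) h.continuous)
    · rw [norm_mul, norm_mul, norm_exp_I_mul_mul, one_mul, RCLike.norm_conj]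
      refine (mul_le_mul (hb s) (hb s) (norm_nonneg _) (by positivity)).trans ?_
      have h1 : (1 + s ^ 2)⁻¹ ≤ 1 := inv_le_one_of_one_le₀ (by nlinarith [sq_nonneg s])
      calc C * (1 + s ^ 2)⁻¹ * (C * (1 + s ^ 2)⁻¹) = C * C * (1 + s ^ 2)⁻¹ * (1 + s ^ 2)⁻¹ := by ring
        _ ≤ C * C * (1 + s ^ 2)⁻¹ * 1 := by gcongr
        _ = _ := mul_one _
    · have hc : Continuous fun δ : ℝ =>
          conj (h s) * (Complex.exp (Complex.I * c * (δ * s : ℝ)) * h s) := by fun_prop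
      simpa using (hc.tendsto 0).mono_left nhdsWithin_le_nhds
  · obtain ⟨C, hC, hb⟩ := exists_overlap_bound h
    refine squeeze_zero_norm' (a := fun δ => C * (δ ^ 2 / r ^ 2)) ?_ ?_
    · filter_upwards [self_mem_nhdsWithin] with δ hδ
      have hδ' : 0 < δ := hδ
      refine (hb c δ r).trans ?_
      gcongr
      have hr2 : 0 < r ^ 2 := by positivity
      rw [inv_le_comm₀ (by positivity) (by positivity), inv_div, div_pow]
      linarith
    · simpa using ((h0.pow 2).div_const (r ^ 2)).const_mul C

end Overlap

section Operators

theorem translation_coeFn (c : ℝ) (F : Mode) :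
    (translation c F : ℝ → ℂ) =ᵐ[volume] fun x => F (x - c) :=
  Lp.coeFn_compMeasurePreserving F (measurePreserving_sub_right volume c)

theorem modulation_coeFn (c : ℝ) (F : Mode) :
    (modulation c F : ℝ → ℂ) =ᵐ[volume] fun x => Complex.exp (Complex.I * c * x) * F x := by
  have h1 := (ContinuousLinearMap.mul ℂ ℂ).coeFn_holder (r := 2) (memLp_phase c).toLp F
  filter_upwards [h1, (memLp_phase c).coeFn_toLp] with x hx hx'
  exact hx.trans (by rw [hx']; rfl)

theorem ae_eq_comp_sub {f g : ℝ → ℂ} (h : f =ᵐ[volume] g) (c : ℝ) :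
    (fun x => f (x - c)) =ᵐ[volume] fun x => g (x - c) :=
  (measurePreserving_sub_right volume c).quasiMeasurePreserving.ae_eq_comp h

theorem norm_translation (c : ℝ) (F : Mode) : ‖translation c F‖ = ‖F‖ :=
  (Lp.compMeasurePreservingₗᵢ ℂ (fun x : ℝ => x - c)
    (measurePreserving_sub_right volume c)).norm_map F

theorem inner_translation_translation_self (c : ℝ) (F G : Mode) :
    inner ℂ (translation c F) (translation c G) = inner ℂ F G :=
  (Lp.compMeasurePreservingₗᵢ ℂ (fun x : ℝ => x - c)
    (measurePreserving_sub_right volume c)).inner_map_map F G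

theorem norm_modulation (c : ℝ) (F : Mode) : ‖modulation c F‖ = ‖F‖ := by
  rw [Lp.norm_def, Lp.norm_def]
  congr 1
  refine eLpNorm_congr_norm_ae ?_
  filter_upwards [modulation_coeFn c F] with x hx
  rw [hx, norm_mul, norm_exp_I_mul_mul, one_mul]

theorem translation_translation (c c' : ℝ) (F : Mode) :
    translation c (translation c' F) = translation (c + c') F := by
  refine Lp.ext ?_
  filter_upwards [translation_coeFn c (translation c' F), translation_coeFn (c + c') F,
    ae_eq_comp_sub (translation_coeFn c' F) c] with x h1 h2 h3
  rw [h1, h2, h3, sub_sub]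

theorem modulation_translation (c r : ℝ) (F : Mode) :
    modulation c (translation r F) =
      Complex.exp (Complex.I * c * r) • translation r (modulation c F) := by
  refine Lp.ext ?_
  filter_upwards [modulation_coeFn c (translation r F), translation_coeFn r F,
    Lp.coeFn_smul (Complex.exp (Complex.I * c * r)) (translation r (modulation c F)),
    translation_coeFn r (modulation c F), ae_eq_comp_sub (modulation_coeFn c F) r]
    with x h1 h2 h3 h4 h5
  rw [h1, h2, h3, Pi.smul_apply, h4, h5, smul_eq_mul, ← mul_assoc, ← Complex.exp_add]
  congr 2
  push_cast
  ring

theorem inner_translation_translation (c c' : ℝ) (F G : Mode) :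
    inner ℂ (translation c F) (translation c' G) = inner ℂ F (translation (c' - c) G) := by
  rw [← inner_translation_translation_self c F, translation_translation, add_sub_cancel]

theorem displacement_apply (d : ℕ) (a : ℝ × ℝ) (F : Mode) :
    displacement d a F = Complex.exp (Complex.I * Real.pi * a.1 * a.2 / d) •
      translation (ell d * a.1) (modulation (ell d * a.2) F) := by
  rw [displacement, smul_apply, ContinuousLinearMap.comp_apply]

theorem norm_displacement_apply (d : ℕ) (a : ℝ × ℝ) (F : Mode) :
    ‖displacement d a F‖ = ‖F‖ := by
  have h : ‖Complex.exp (Complex.I * Real.pi * a.1 * a.2 / d)‖ = 1 := by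
    have e : Complex.I * Real.pi * a.1 * a.2 / d = ↑(Real.pi * a.1 * a.2 / d) * Complex.I := by
      push_cast; ring
    rw [e, Complex.norm_exp_ofReal_mul_I]
  rw [displacement_apply, norm_smul, h, one_mul, norm_translation, norm_modulation]

theorem norm_displacement_le (d : ℕ) (a : ℝ × ℝ) : ‖displacement d a‖ ≤ 1 :=
  ContinuousLinearMap.opNorm_le_bound _ zero_le_one fun F => by
    rw [norm_displacement_apply, one_mul]

theorem displacement_zero (d : ℕ) (F : Mode) : displacement d ((0 : ℝ), (0 : ℝ)) F = F := by
  rw [displacement_apply]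
  refine Lp.ext ?_
  filter_upwards [Lp.coeFn_smul (Complex.exp (Complex.I * Real.pi * (0 : ℝ) * (0 : ℝ) / d))
      (translation (ell d * 0) (modulation (ell d * 0) F)),
    translation_coeFn (ell d * 0) (modulation (ell d * 0) F),
    ae_eq_comp_sub (modulation_coeFn (ell d * 0) F) (ell d * 0)] with x h1 h2 h3
  rw [h1, Pi.smul_apply, h2, h3]
  simp

theorem coeFn_tsum {F : ℤ → Mode} (hF : Summable F) {f : ℤ → ℝ → ℂ}
    (hf : ∀ n, (F n : ℝ → ℂ) =ᵐ[volume] f n) (hs : ∀ x, Summable fun n => f n x) :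
    ((∑' n, F n : Mode) : ℝ → ℂ) =ᵐ[volume] fun x => ∑' n, f n x := by
  obtain ⟨ns, h1, h2⟩ :=
    (tendstoInMeasure_of_tendsto_Lp hF.hasSum).exists_seq_tendsto_ae'
  have h3 : ∀ i, ((∑ n ∈ ns i, F n : Mode) : ℝ → ℂ) =ᵐ[volume] ∑ n ∈ ns i, ⇑(F n) :=
    fun i => Lp.coeFn_finsetSum _ _
  filter_upwards [h2, ae_all_iff.2 hf, ae_all_iff.2 h3] with x hx hfx hx3
  refine tendsto_nhds_unique hx ?_
  have h4 := (hs x).hasSum.comp h1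
  refine h4.congr fun i => ?_
  rw [hx3, Finset.sum_apply]
  exact Finset.sum_congr rfl fun n _ => (hfx n).symm

theorem inner_tsum_tsum {E : Type*} [NormedAddCommGroup E] [InnerProductSpace ℂ E]
    [CompleteSpace E] {A B : ℤ → E} (hA : Summable fun n => ‖A n‖) (hB : Summable fun n => ‖B n‖) :
    inner ℂ (∑' n, A n) (∑' n, B n) = ∑' q, ∑' n, inner ℂ (A (n - q)) (B n) := by
  have S : Summable fun p : ℤ × ℤ => inner ℂ (A p.1) (B p.2) :=
    Summable.of_norm_bounded (hA.mul_of_nonneg hB (fun _ => norm_nonneg _) fun _ => norm_nonneg _)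
      fun p => norm_inner_le_norm _ _
  let e : ℤ × ℤ ≃ ℤ × ℤ :=
    ⟨fun p => (p.2 - p.1, p.2), fun p => (p.2 - p.1, p.2), fun p => by simp, fun p => by simp⟩
  have h1 : ∑' p : ℤ × ℤ, inner ℂ (A p.1) (B p.2) = inner ℂ (∑' n, A n) (∑' n, B n) := by
    rw [S.tsum_prod]
    have h2 : ∀ m, ∑' n, inner ℂ (A m) (B n) = inner ℂ (A m) (∑' n, B n) := fun m =>
      (hB.of_norm.hasSum.mapL (innerSL ℂ (A m))).tsum_eq
    simp_rw [h2]
    exact (hA.of_norm.hasSum.mapL (innerSLFlip ℂ (∑' n, B n))).tsum_eq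
  rw [← h1, ← e.tsum_eq]
  exact (e.summable_iff.2 S).tsum_prod

end Operators

section Trace

open InnerProductSpace

variable {ι : Type*} [Fintype ι]

/-- The operator `∑_{j,k} ρ_{jk} |u_j⟩⟨u_k|`. -/
noncomputable def mixture (ρ : Matrix ι ι ℂ) (u : ι → Mode) : Mode →L[ℂ] Mode :=
  ∑ j, ∑ k, ρ j k • rankOne ℂ (u j) (u k)

theorem trace_mixture_comp (ρ : Matrix ι ι ℂ) (u : ι → Mode) (B : Mode →L[ℂ] Mode) :
    trace (mixture ρ u ∘L B) = ∑ j, ∑ k, ρ j k * inner ℂ (u k) (B (u j)) := by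
  refine HasSum.tsum_eq ?_
  set b := (exists_hilbertBasis ℂ Mode).choose_spec.choose
  have h : ∀ i, inner ℂ (b i) ((mixture ρ u ∘L B) (b i)) =
      ∑ j, ∑ k, ρ j k * (inner ℂ (B.adjoint (u k)) (b i) * inner ℂ (b i) (u j)) := fun i => by
    simp [mixture, inner_sum, inner_smul_right, ContinuousLinearMap.adjoint_inner_left]
  simp_rw [h, ← ContinuousLinearMap.adjoint_inner_left B]
  exact hasSum_sum fun j _ => hasSum_sum fun k _ => (b.hasSum_inner_mul_inner _ _).mul_left _

theorem trace_mixture (ρ : Matrix ι ι ℂ) (u : ι → Mode) :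
    trace (mixture ρ u) = ∑ j, ∑ k, ρ j k * inner ℂ (u k) (u j) :=
  trace_mixture_comp ρ u (ContinuousLinearMap.id ℂ Mode)

theorem trace_smul_comp (c : ℂ) (A B : Mode →L[ℂ] Mode) :
    trace ((c • A) ∘L B) = c * trace (A ∘L B) := by
  simp [trace, inner_smul_right, tsum_mul_left]

theorem isIntegralOperator_mixture (ρ : Matrix ι ι ℂ) {u : ι → Mode} {v : ι → ℝ → ℂ}
    (h : ∀ j, (u j : ℝ → ℂ) =ᵐ[volume] v j) :
    IsIntegralOperator (fun x y => ∑ j, ∑ k, ρ j k * (conj (v k y) * v j x)) (mixture ρ u) := by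
  intro ψ
  have hint : ∀ k, Integrable fun y => conj (v k y) * ψ y := fun k => by
    refine (L2.integrable_inner (u k) ψ).congr ?_
    filter_upwards [h k] with y hy
    rw [RCLike.inner_apply, hy, mul_comm]
  have hin : ∀ k, inner ℂ (u k) ψ = ∫ y, conj (v k y) * ψ y := fun k => by
    rw [L2.inner_def]
    refine integral_congr_ae ?_
    filter_upwards [h k] with y hy
    rw [RCLike.inner_apply, hy, mul_comm]
  have e : mixture ρ u ψ = ∑ j, (∑ k, ρ j k * inner ℂ (u k) ψ) • u j := by
    simp [mixture, Finset.sum_smul, mul_smul]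
  rw [e]
  have h2 : ∀ j, (((∑ k, ρ j k * inner ℂ (u k) ψ) • u j : Mode) : ℝ → ℂ) =ᵐ[volume]
      fun x => (∑ k, ρ j k * inner ℂ (u k) ψ) * v j x := fun j => by
    filter_upwards [Lp.coeFn_smul (∑ k, ρ j k * inner ℂ (u k) ψ) (u j), h j] with x hx hx'
    rw [hx, Pi.smul_apply, hx', smul_eq_mul]
  filter_upwards [Lp.coeFn_finsetSum Finset.univ
    fun j => (∑ k, ρ j k * inner ℂ (u k) ψ) • u j, ae_all_iff.2 h2] with x hx hx2
  rw [hx, Finset.sum_apply]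
  simp_rw [hx2]
  have h3 : ∀ y, (∑ j, ∑ k, ρ j k * (conj (v k y) * v j x)) * ψ y =
      ∑ j, ∑ k, ρ j k * v j x * (conj (v k y) * ψ y) := fun y => by
    rw [Finset.sum_mul]
    refine Finset.sum_congr rfl fun j _ => ?_
    rw [Finset.sum_mul]
    exact Finset.sum_congr rfl fun k _ => by ring
  simp_rw [h3]
  rw [integral_finsetSum _ fun j _ => integrable_finsetSum _ fun k _ => (hint k).const_mul _]
  refine Finset.sum_congr rfl fun j _ => ?_
  rw [integral_finsetSum _ fun k _ => (hint k).const_mul _, Finset.sum_mul]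
  refine Finset.sum_congr rfl fun k _ => ?_
  rw [integral_const_mul, hin]
  ring

theorem IsIntegralOperator.unique {k : ℝ → ℝ → ℂ} {A B : Mode →L[ℂ] Mode}
    (hA : IsIntegralOperator k A) (hB : IsIntegralOperator k B) : A = B :=
  ContinuousLinearMap.ext fun ψ => Lp.ext ((hA ψ).trans (hB ψ).symm)

end Trace

section Codewords

/-- The regularized position eigenstate `δ⁻¹ h (· / δ)`. -/
noncomputable def wavePacket (h : 𝓢(ℝ, ℂ)) (δ : ℝ) : Mode :=
  if hδ : 0 < δ then (((δ : ℂ)⁻¹) • dilate h (inv_ne_zero hδ.ne')).toLp 2 else 0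

theorem dilate_apply (f : 𝓢(ℝ, ℂ)) {c : ℝ} (hc : c ≠ 0) (x : ℝ) : dilate f hc x = f (c * x) := by
  simp [dilate, Units.smul_def]

theorem wavePacket_coeFn (h : 𝓢(ℝ, ℂ)) {δ : ℝ} (hδ : 0 < δ) :
    (wavePacket h δ : ℝ → ℂ) =ᵐ[volume] fun x => (δ : ℂ)⁻¹ * h (x / δ) := by
  rw [wavePacket, dif_pos hδ]
  filter_upwards [((((δ : ℂ)⁻¹) • dilate h (inv_ne_zero hδ.ne')).coeFn_toLp 2)] with x hx
  rw [hx, smul_apply, dilate_apply, smul_eq_mul, inv_mul_eq_div δ x]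

theorem inner_wavePacket (h : 𝓢(ℝ, ℂ)) {δ : ℝ} (hδ : 0 < δ) (c r : ℝ) :
    inner ℂ (wavePacket h δ) (translation r (modulation c (wavePacket h δ))) =
      (δ : ℂ)⁻¹ * overlap h c δ r := by
  have hδ' : (δ : ℂ) ≠ 0 := by exact_mod_cast hδ.ne'
  let G : ℝ → ℂ := fun x => conj ((δ : ℂ)⁻¹ * h (x / δ)) *
    (Complex.exp (Complex.I * c * (x - r : ℝ)) * ((δ : ℂ)⁻¹ * h ((x - r) / δ)))
  have e : inner ℂ (wavePacket h δ) (translation r (modulation c (wavePacket h δ))) =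
      ∫ x, G x := by
    rw [L2.inner_def]
    refine integral_congr_ae ?_
    filter_upwards [wavePacket_coeFn h hδ, translation_coeFn r (modulation c (wavePacket h δ)),
      ae_eq_comp_sub (modulation_coeFn c (wavePacket h δ)) r,
      ae_eq_comp_sub (wavePacket_coeFn h hδ) r] with x h1 h2 h3 h4
    rw [RCLike.inner_apply, h1, h2, h3, h4, mul_comm]
  have h2 := Measure.integral_comp_mul_left G δ
  rw [abs_of_pos (inv_pos.2 hδ), Complex.real_smul] at h2
  have h3 : ∀ s : ℝ, G (δ * s) = ((δ : ℂ)⁻¹ * (δ : ℂ)⁻¹) *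
      (conj (h s) * (Complex.exp (Complex.I * c * (δ * s - r : ℝ)) * h (s - r / δ))) := fun s => by
    have e1 : δ * s / δ = s := by field_simp
    have e2 : (δ * s - r) / δ = s - r / δ := by field_simp
    simp only [G, e1, e2, map_mul, map_inv₀, Complex.conj_ofReal]
    ring
  simp_rw [h3] at h2
  rw [integral_const_mul, Complex.ofReal_inv] at h2
  rw [e]
  have h4 := mul_left_cancel₀ (inv_ne_zero hδ') ((mul_assoc _ _ _).symm.trans h2)
  exact h4.symm

theorem ell_sq (d : ℕ) : ell d * ell d = 2 * Real.pi / d := by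
  rw [ell, Real.mul_self_sqrt (by positivity)]

variable {d : ℕ} [NeZero d]

theorem summable_norm_weight (g : 𝓢(ℝ, ℂ)) {ε : ℝ} (hε : 0 < ε) (j : ZMod d) :
    Summable fun n : ℤ => ‖g (ε * gkpPoint d j n)‖ := by
  simpa [dilate_apply] using (summable_gkp d j (dilate g hε.ne')).norm

variable (d) in
/-- The regularized codeword `E |j_GKP⟩`. -/
noncomputable def codeword (g h : 𝓢(ℝ, ℂ)) (ε δ : ℝ) (j : ZMod d) : Mode :=
  (1 / Real.sqrt (ell d) : ℂ) •
    ∑' n : ℤ, g (ε * gkpPoint d j n) • translation (gkpPoint d j n) (wavePacket h δ)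

theorem summable_norm_codeword (g h : 𝓢(ℝ, ℂ)) {ε : ℝ} (hε : 0 < ε) (δ : ℝ) (j : ZMod d) :
    Summable fun n : ℤ =>
      ‖g (ε * gkpPoint d j n) • translation (gkpPoint d j n) (wavePacket h δ)‖ := by
  simp_rw [norm_smul, norm_translation]
  exact (summable_norm_weight g hε j).mul_right _

theorem gkpKet_apply (j : ZMod d) (φ : 𝓢(ℝ, ℂ)) :
    gkpKet d j φ = (1 / Real.sqrt (ell d) : ℂ) * ∑' n : ℤ, φ (gkpPoint d j n) := rfl

theorem codeword_coeFn (g h : 𝓢(ℝ, ℂ)) {ε δ : ℝ} (hε : 0 < ε) (hδ : 0 < δ) (j : ZMod d) :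
    (codeword d g h ε δ j : ℝ → ℂ) =ᵐ[volume] fun x => gkpKet d j (regRow g h hε hδ x) := by
  have h1 := coeFn_tsum (summable_norm_codeword g h hε δ j).of_norm
    (f := fun n x => regRow g h hε hδ x (gkpPoint d j n)) (fun n => ?_)
    (fun x => summable_gkp d j _)
  · filter_upwards [h1, Lp.coeFn_smul (1 / Real.sqrt (ell d) : ℂ)
      (∑' n : ℤ, g (ε * gkpPoint d j n) • translation (gkpPoint d j n) (wavePacket h δ))]
      with x hx hx'
    rw [codeword, hx', Pi.smul_apply, hx, gkpKet_apply, smul_eq_mul]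
  · filter_upwards [Lp.coeFn_smul (g (ε * gkpPoint d j n))
      (translation (gkpPoint d j n) (wavePacket h δ)),
      translation_coeFn (gkpPoint d j n) (wavePacket h δ),
      ae_eq_comp_sub (wavePacket_coeFn h hδ) (gkpPoint d j n)] with x h1 h2 h3
    rw [h1, Pi.smul_apply, h2, h3, regRow_apply, smul_eq_mul]
    ring

theorem regKernel_gkpEncode (ρ : Matrix (ZMod d) (ZMod d) ℂ) (g h : 𝓢(ℝ, ℂ)) {ε δ : ℝ}
    (hε : 0 < ε) (hδ : 0 < δ) (x y : ℝ) :
    regKernel g h hε hδ (gkpEncode d ρ) x y = ∑ j, ∑ k, ρ j k *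
      (conj (gkpKet d k (regRow g h hε hδ y)) * gkpKet d j (regRow g h hε hδ x)) := by
  have hcc : ∀ φ : 𝓢(ℝ, ℂ), schwartzConj (schwartzConj φ) = φ := fun φ => by ext x; simp
  have hkb : ∀ (u v : 𝓢'(ℝ, ℂ)) (φ χ : 𝓢(ℝ, ℂ)),
      ketBra u v φ χ = conj (v (schwartzConj φ)) * u χ := fun _ _ _ _ => rfl
  simp only [regKernel, gkpEncode, sum_apply, smul_apply, hkb, hcc, smul_eq_mul]

theorem isIntegralOperator_codeword (ρ : Matrix (ZMod d) (ZMod d) ℂ) (g h : 𝓢(ℝ, ℂ)) {ε δ : ℝ}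
    (hε : 0 < ε) (hδ : 0 < δ) :
    IsIntegralOperator (regKernel g h hε hδ (gkpEncode d ρ))
      (mixture ρ (codeword d g h ε δ)) := by
  have e := isIntegralOperator_mixture ρ (u := codeword d g h ε δ)
    fun j => codeword_coeFn g h hε hδ j
  simp_rw [← regKernel_gkpEncode] at e
  exact e

theorem exp_gkpPoint (j : ZMod d) (n a : ℤ) :
    Complex.exp (Complex.I * (ell d * a : ℝ) * gkpPoint d j n) = omega d (a * j) := by
  have e : (a : ZMod d) * j = ((a * (d * n + j.val) : ℤ) : ZMod d) := by simp
  have hl : (ell d : ℂ) * ell d = 2 * Real.pi / d := by exact_mod_cast ell_sq d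
  rw [e, omega_intCast, gkpPoint]
  congr 1
  push_cast
  linear_combination Complex.I * a * (d * n + (j.val : ℂ)) * hl

theorem inner_codeword (g h : 𝓢(ℝ, ℂ)) {ε δ : ℝ} (hε : 0 < ε) (hδ : 0 < δ) (j k : ZMod d)
    (a : ℤ × ℤ) :
    ((ε * δ : ℝ) : ℂ) * inner ℂ (codeword d g h ε δ k)
        (displacement d ((a.1 : ℝ), (a.2 : ℝ)) (codeword d g h ε δ j)) =
      (Complex.exp (Complex.I * Real.pi * a.1 * a.2 / d) * omega d (a.2 * j) * (ell d : ℂ)⁻¹) *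
        ∑' q : ℤ, overlap h (ell d * a.2) δ (ell d * (a.1 + d * q + j.val - k.val)) *
          (ε * ∑' n : ℤ, conj (g (ε * gkpPoint d k (n - q))) * g (ε * gkpPoint d j n)) := by
  have hδ' : (δ : ℂ) ≠ 0 := by exact_mod_cast hδ.ne'
  have hB := summable_norm_codeword g h hε δ j
  have hdisp : displacement d ((a.1 : ℝ), (a.2 : ℝ)) (codeword d g h ε δ j) =
      (1 / Real.sqrt (ell d) : ℂ) • ∑' n : ℤ, displacement d ((a.1 : ℝ), (a.2 : ℝ))
        (g (ε * gkpPoint d j n) • translation (gkpPoint d j n) (wavePacket h δ)) := by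
    rw [codeword, map_smul, ContinuousLinearMap.map_tsum _ hB.of_norm]
  have hterm : ∀ q n : ℤ, inner ℂ
      (g (ε * gkpPoint d k (n - q)) • translation (gkpPoint d k (n - q)) (wavePacket h δ))
      (displacement d ((a.1 : ℝ), (a.2 : ℝ))
        (g (ε * gkpPoint d j n) • translation (gkpPoint d j n) (wavePacket h δ))) =
      (Complex.exp (Complex.I * Real.pi * a.1 * a.2 / d) * omega d (a.2 * j) * (δ : ℂ)⁻¹ *
        overlap h (ell d * a.2) δ (ell d * (a.1 + d * q + j.val - k.val))) *
          (conj (g (ε * gkpPoint d k (n - q))) * g (ε * gkpPoint d j n)) := fun q n => by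
    rw [map_smul, displacement_apply, modulation_translation, map_smul, translation_translation,
      inner_smul_left, inner_smul_right, inner_smul_right, inner_smul_right,
      inner_translation_translation, inner_wavePacket h hδ, exp_gkpPoint]
    have e : ell d * (a.1 : ℝ) + gkpPoint d j n - gkpPoint d k (n - q) =
        ell d * (a.1 + d * q + j.val - k.val) := by
      simp only [gkpPoint]; push_cast; ring
    simp only [e, Complex.ofReal_intCast]
    ring
  have hsq : conj (1 / Real.sqrt (ell d) : ℂ) * (1 / Real.sqrt (ell d) : ℂ) = (ell d : ℂ)⁻¹ := by
    have h1 : Real.sqrt (ell d) * Real.sqrt (ell d) = ell d :=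
      Real.mul_self_sqrt (ell_pos d).le
    rw [map_div₀, map_one, Complex.conj_ofReal, div_mul_div_comm, ← Complex.ofReal_mul, h1]
    simp
  rw [hdisp, codeword, inner_smul_left, inner_smul_right,
    inner_tsum_tsum (summable_norm_codeword g h hε δ k) (by simp only [norm_displacement_apply]; exact hB)]
  simp_rw [hterm, tsum_mul_left]
  simp_rw [mul_assoc, tsum_mul_left]
  rw [← mul_assoc (conj _), hsq]
  have h5 : ∀ q : ℤ, overlap h (ell d * a.2) δ (ell d * (a.1 + d * q + j.val - k.val)) *
          (ε * ∑' n : ℤ, conj (g (ε * gkpPoint d k (n - q))) * g (ε * gkpPoint d j n)) =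
      ε * (overlap h (ell d * a.2) δ (ell d * (a.1 + d * q + j.val - k.val)) *
          (∑' n : ℤ, conj (g (ε * gkpPoint d k (n - q))) * g (ε * gkpPoint d j n))) :=
    fun q => by ring
  simp_rw [h5, tsum_mul_left]
  push_cast
  field_simp

theorem lattice_index_iff (j k : ZMod d) (a q : ℤ) :
    ell d * (a + d * q + j.val - k.val) = 0 ↔ (k.val : ℤ) - j.val - a = d * q := by
  rw [mul_eq_zero, or_iff_right (ell_pos d).ne', sub_eq_zero]
  constructor
  · intro h
    have h' : (a : ℤ) + d * q + j.val = k.val := by exact_mod_cast h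
    omega
  · intro h
    have h' : (a : ℤ) + d * q + j.val = k.val := by omega
    exact_mod_cast h'

theorem tsum_lattice_index (j k : ZMod d) (a : ℤ) (z : ℂ) :
    ∑' q : ℤ, (if ell d * (a + d * q + j.val - k.val) = 0 then z else 0) =
      if k = j + a then z else 0 := by
  have hd : (d : ℤ) ≠ 0 := by exact_mod_cast NeZero.ne d
  simp_rw [lattice_index_iff]
  have hk : k = j + a ↔ (d : ℤ) ∣ (k.val : ℤ) - j.val - a := by
    rw [← ZMod.intCast_zmod_eq_zero_iff_dvd]
    simp [sub_sub, sub_eq_zero]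
  split_ifs with h
  · obtain ⟨q, hq⟩ := hk.1 h
    rw [tsum_eq_single q, if_pos hq]
    intro q' hq'
    exact if_neg fun h' => hq' (mul_left_cancel₀ hd (h'.symm.trans hq))
  · rw [tsum_congr fun q => if_neg fun h' => h (hk.2 ⟨q, h'⟩), tsum_zero]

variable (d) in
/-- The limit of `ε δ Tr (E E†)` per codeword. -/
noncomputable def overlapLimit (g h : 𝓢(ℝ, ℂ)) : ℂ :=
  (ell d : ℂ)⁻¹ * ((∫ s, conj (h s) * h s) *
    (((d * ell d : ℝ) : ℂ)⁻¹ * ∫ x, conj (g x) * g x))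

theorem integral_conj_mul_self_ne_zero (g : 𝓢(ℝ, ℂ)) (hg : g ≠ 0) :
    ∫ x, conj (g x) * g x ≠ 0 := by
  have h := g.inner_toL2_toL2_eq g volume
  simp only [RCLike.inner_apply] at h
  simp_rw [mul_comm (conj _)]
  rw [← h]
  refine inner_self_ne_zero.2 fun h0 => hg ?_
  refine injective_toLp (F := ℂ) 2 volume ?_
  change g.toLp 2 volume = (0 : 𝓢(ℝ, ℂ)).toLp 2 volume
  rw [h0]
  exact ((toLpCLM ℂ ℂ 2 volume).map_zero).symm

theorem overlapLimit_ne_zero {g h : 𝓢(ℝ, ℂ)} (hg : g 0 = 1) (hh : ∫ x, h x = 1) :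
    overlapLimit d g h ≠ 0 := by
  have hl : (ell d : ℂ) ≠ 0 := by exact_mod_cast (ell_pos d).ne'
  have hd : (d : ℂ) ≠ 0 := NeZero.ne _
  have h1 := integral_conj_mul_self_ne_zero g (by rintro rfl; simp at hg)
  have h2 := integral_conj_mul_self_ne_zero h (by rintro rfl; simp at hh)
  unfold overlapLimit
  push_cast
  positivity

theorem tendsto_inner_codeword (g h : 𝓢(ℝ, ℂ)) (j k : ZMod d) (a : ℤ × ℤ) :
    Tendsto (fun p : ℝ × ℝ => ((p.1 * p.2 : ℝ) : ℂ) * inner ℂ (codeword d g h p.1 p.2 k)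
        (displacement d ((a.1 : ℝ), (a.2 : ℝ)) (codeword d g h p.1 p.2 j)))
      (𝓝[>] 0 ×ˢ 𝓝[>] 0)
      (𝓝 (overlapLimit d g h * if k = j + a.1 then
        Complex.exp (Complex.I * Real.pi * a.1 * a.2 / d) * omega d (a.2 * j) else 0)) := by
  have hd : (0 : ℝ) < d := by exact_mod_cast Nat.pos_of_neZero d
  have hl := ell_pos d
  have hs : 0 < d * ell d := by positivity
  obtain ⟨C, hC, hover⟩ := exists_overlap_bound h
  obtain ⟨Cg, hCg, hg⟩ := exists_decay_bound_real g 1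
  simp only [pow_one] at hg
  have hg' : ∀ x, ‖g x‖ ≤ Cg := fun x =>
    (hg x).trans (mul_le_of_le_one_right hCg (inv_le_one_of_one_le₀ (by nlinarith [sq_nonneg x])))
  have hpt : ∀ (i : ZMod d) (n : ℤ), gkpPoint d i n = d * ell d * n + i.val * ell d := fun i n => by
    rw [gkpPoint]; ring
  have hpt' : ∀ (i : ZMod d) (n q : ℤ),
      gkpPoint d i (n - q) = d * ell d * n + (i.val - d * q) * ell d := fun i n q => by
    rw [gkpPoint]; push_cast; ring
  let R : ℤ → ℝ → ℂ := fun q ε =>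
    ε * ∑' n : ℤ, conj (g (ε * gkpPoint d k (n - q))) * g (ε * gkpPoint d j n)
  have hR : ∀ q, Tendsto (R q) (𝓝[>] 0)
      (𝓝 (((d * ell d : ℝ) : ℂ)⁻¹ * ∫ x, conj (g x) * g x)) := fun q => by
    have := tendsto_riemannSum (u := fun x => conj (g x)) (v := g)
      (Complex.continuous_conj.comp g.continuous) g.continuous
      (fun x => by rw [RCLike.norm_conj]; exact hg' x) hg hs ((k.val - d * q) * ell d)
      (j.val * ell d)
    simp_rw [← hpt, ← hpt'] at this
    exact this
  obtain ⟨M, hM⟩ : ∃ M : ℝ, ∀ᶠ ε : ℝ in 𝓝[>] 0, ∀ q, ‖R q ε‖ ≤ M := by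
    have h1 := (tendsto_riemannSum (u := fun _ => (1 : ℂ)) (v := fun x => (‖g x‖ : ℂ))
      continuous_const (Complex.continuous_ofReal.comp g.continuous.norm) (Cu := 1) (Cv := Cg)
      (fun x => by simp) (fun x => by simpa using hg x) hs 0 (j.val * ell d)).norm
    simp_rw [← hpt, one_mul] at h1
    obtain ⟨M, hM⟩ := h1.isBoundedUnder_le
    refine ⟨Cg * M, ?_⟩
    filter_upwards [eventually_map.1 hM, self_mem_nhdsWithin] with ε hε hε0 q
    have hε0' : (0 : ℝ) < ε := hε0
    have hS := summable_norm_weight g hε0' j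
    have h2 : ‖∑' n : ℤ, conj (g (ε * gkpPoint d k (n - q))) * g (ε * gkpPoint d j n)‖ ≤
        Cg * ∑' n : ℤ, ‖g (ε * gkpPoint d j n)‖ := by
      refine tsum_of_norm_bounded (hS.hasSum.mul_left Cg) fun n => ?_
      rw [norm_mul, RCLike.norm_conj]
      gcongr
      exact hg' _
    have h3 : ‖(ε : ℂ) * ∑' n : ℤ, (‖g (ε * gkpPoint d j n)‖ : ℂ)‖ =
        ε * ∑' n : ℤ, ‖g (ε * gkpPoint d j n)‖ := by
      rw [← Complex.ofReal_tsum, ← Complex.ofReal_mul, Complex.norm_real,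
        Real.norm_of_nonneg (mul_nonneg hε0'.le (tsum_nonneg fun _ => norm_nonneg _))]
    rw [h3] at hε
    calc ‖R q ε‖ = ε * ‖∑' n : ℤ, conj (g (ε * gkpPoint d k (n - q))) * g (ε * gkpPoint d j n)‖ := by
          rw [norm_mul, Complex.norm_real, Real.norm_of_nonneg hε0'.le]
      _ ≤ ε * (Cg * ∑' n : ℤ, ‖g (ε * gkpPoint d j n)‖) := by gcongr
      _ = Cg * (ε * ∑' n : ℤ, ‖g (ε * gkpPoint d j n)‖) := by ring
      _ ≤ Cg * M := by gcongr
  have hsum : Tendsto (fun p : ℝ × ℝ => ∑' q : ℤ,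
      overlap h (ell d * a.2) p.2 (ell d * (a.1 + d * q + j.val - k.val)) * R q p.1)
      (𝓝[>] 0 ×ˢ 𝓝[>] 0) (𝓝 (∑' q : ℤ,
        if ell d * (a.1 + d * q + j.val - k.val) = 0 then (∫ s, conj (h s) * h s) *
          (((d * ell d : ℝ) : ℂ)⁻¹ * ∫ x, conj (g x) * g x) else 0)) := by
    refine tendsto_tsum_of_dominated_convergence (bound := fun q : ℤ =>
        C * (1 + (ell d * d * q + ell d * (a.1 + j.val - k.val)) ^ 2)⁻¹ * M)
      (((summable_inv_one_add_affine_sq (mul_pos hl hd).ne' _).mul_left C).mul_right M)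
      (fun q => ?_) ?_
    · have h1 := ((tendsto_overlap h (ell d * a.2)
        (ell d * (a.1 + d * q + j.val - k.val))).comp tendsto_snd).mul ((hR q).comp tendsto_fst)
      rw [ite_mul, zero_mul] at h1
      exact h1
    · have hδ : ∀ᶠ δ : ℝ in 𝓝[>] 0, 0 < δ ∧ δ ≤ 1 :=
        (Ioc_mem_nhdsGT one_pos : Set.Ioc (0 : ℝ) 1 ∈ 𝓝[>] 0)
      filter_upwards [hM.prod_mk hδ] with p hp q
      obtain ⟨hp1, hδ0, hδ1⟩ := hp
      rw [norm_mul]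
      refine mul_le_mul ((hover _ _ _).trans ?_) (hp1 q) (norm_nonneg _) (by positivity)
      have e : ell d * d * q + ell d * (a.1 + j.val - k.val) =
          ell d * (a.1 + d * q + j.val - k.val) := by ring
      rw [e]
      refine mul_le_mul_of_nonneg_left (inv_anti₀ (by positivity) ?_) hC
      rw [div_pow]
      have := le_div_self (sq_nonneg (ell d * (a.1 + d * q + j.val - k.val))) (by positivity)
        (pow_le_one₀ (n := 2) hδ0.le hδ1)
      linarith
  rw [tsum_lattice_index] at hsum
  have hfin := hsum.const_mul
    (Complex.exp (Complex.I * Real.pi * a.1 * a.2 / d) * omega d (a.2 * j) * (ell d : ℂ)⁻¹)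
  have elim : (Complex.exp (Complex.I * Real.pi * a.1 * a.2 / d) * omega d (a.2 * j) *
      (ell d : ℂ)⁻¹) * (if k = j + a.1 then (∫ s, conj (h s) * h s) *
          (((d * ell d : ℝ) : ℂ)⁻¹ * ∫ x, conj (g x) * g x) else 0) =
      overlapLimit d g h * if k = j + a.1 then
        Complex.exp (Complex.I * Real.pi * a.1 * a.2 / d) * omega d (a.2 * j) else 0 := by
    unfold overlapLimit
    split_ifs <;> ring
  rw [elim] at hfin
  refine hfin.congr' ?_
  have hpos : ∀ᶠ p : ℝ × ℝ in 𝓝[>] 0 ×ˢ 𝓝[>] 0, 0 < p.1 ∧ 0 < p.2 :=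
    prod_mem_prod self_mem_nhdsWithin self_mem_nhdsWithin
  filter_upwards [hpos] with p hp
  exact (inner_codeword g h hp.1 hp.2 j k a).symm

end Codewords

open scoped FourierTransform

variable {d : ℕ} [NeZero d]

section LatticeComb

theorem summable_latticeWeight (d : ℕ) [NeZero d] :
    Summable fun a : ℤ × ℤ => ((1 + ‖latticePoint d a‖ ^ 2)⁻¹) ^ 2 := by
  have h := summable_inv_one_add_mul_sq (ell_pos d).ne'
  exact Summable.of_nonneg_of_le (fun _ => by positivity) (fun a => inv_one_add_norm_sq_le _ _)
    (h.mul_of_nonneg h (fun _ => by positivity) fun _ => by positivity)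

theorem norm_weight_le (w : ZMod d × ZMod d → ℂ) (t : ZMod d × ZMod d) : ‖w t‖ ≤ ∑ s, ‖w s‖ :=
  Finset.single_le_sum (f := fun s => ‖w s‖) (fun _ _ => norm_nonneg _) (Finset.mem_univ t)

theorem norm_latticeComb_term_le (w : ZMod d × ZMod d → ℂ) (f : 𝓢(Phase, ℂ)) (a : ℤ × ℤ) :
    ‖w ((a.1 : ZMod d), (a.2 : ZMod d)) * f (latticePoint d a)‖ ≤
      (∑ s, ‖w s‖) * (2 ^ (2 * 2) * (Finset.Iic (2 * 2, 0)).sup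
        (schwartzSeminormFamily ℂ Phase ℂ) f) * ((1 + ‖latticePoint d a‖ ^ 2)⁻¹) ^ 2 := by
  rw [norm_mul, mul_assoc]
  exact mul_le_mul (norm_weight_le _ _) (decay_bound f 2 _) (norm_nonneg _) (by positivity)

theorem summable_latticeComb (w : ZMod d × ZMod d → ℂ) (f : 𝓢(Phase, ℂ)) :
    Summable fun a : ℤ × ℤ =>
      w ((a.1 : ZMod d), (a.2 : ZMod d)) * f (latticePoint d a) :=
  Summable.of_norm_bounded ((summable_latticeWeight d).mul_left _) (norm_latticeComb_term_le w f)

/-- The tempered distribution `∑ₐ w(a mod d) δ(η - ℓ a)`. -/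
noncomputable def latticeComb (w : ZMod d × ZMod d → ℂ) : 𝓢'(Phase, ℂ) :=
  ContinuousLinearMap.toPointwiseConvergenceCLM _ _ _ _ <|
    mkCLMtoNormedSpace (σ := RingHom.id ℂ)
      (fun f : 𝓢(Phase, ℂ) =>
        ∑' a : ℤ × ℤ, w ((a.1 : ZMod d), (a.2 : ZMod d)) * f (latticePoint d a))
      (fun f f' => by
        simp only [add_apply, mul_add]
        exact (summable_latticeComb w f).tsum_add (summable_latticeComb w f'))
      (fun c f => by
        simp only [smul_apply, smul_eq_mul, RingHom.id_apply, mul_left_comm _ c]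
        rw [tsum_mul_left])
      ⟨Finset.Iic (2 * 2, 0), (∑ s, ‖w s‖) * 2 ^ (2 * 2) *
        ∑' a : ℤ × ℤ, ((1 + ‖latticePoint d a‖ ^ 2)⁻¹) ^ 2, by positivity, fun f =>
          (tsum_of_norm_bounded ((summable_latticeWeight d).hasSum.mul_left _)
            (norm_latticeComb_term_le w f)).trans (le_of_eq (by ring))⟩

theorem latticeComb_apply (w : ZMod d × ZMod d → ℂ) (f : 𝓢(Phase, ℂ)) :
    latticeComb w f =
      ∑' a : ℤ × ℤ, w ((a.1 : ZMod d), (a.2 : ZMod d)) * f (latticePoint d a) := rfl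

theorem hasSum_latticeComb (w : ZMod d × ZMod d → ℂ) :
    HasSum (fun a : ℤ × ℤ => w ((a.1 : ZMod d), (a.2 : ZMod d)) •
      TemperedDistribution.delta (latticePoint d a)) (latticeComb w) := by
  refine PointwiseConvergenceCLM.tendsto_iff_forall_tendsto.2 fun f => ?_
  refine (summable_latticeComb w f).hasSum.congr fun s => ?_
  simp [sum_apply]

theorem isNonneg_latticeComb {w : ZMod d × ZMod d → ℂ} (hw : ∀ t, 0 ≤ w t) :
    IsNonneg (latticeComb w) := fun f hf => by
  rw [latticeComb_apply]
  exact tsum_nonneg fun a => mul_nonneg (hw _) (hf _)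

end LatticeComb

section GrossPoisson

theorem latticePoint_residue (t : ZMod d × ZMod d) (b : ℤ × ℤ) :
    latticePoint d (t.1.val + d * b.1, t.2.val + d * b.2) =
      (d * ell d) • !₂[(b.1 : ℝ), (b.2 : ℝ)] + !₂[ell d * (t.1.val : ℝ), ell d * (t.2.val : ℝ)] := by
  ext i
  fin_cases i <;> simp [latticePoint] <;> ring

/-- A sum over `ℤ²` weighted by residues splits into sums over the residue classes. -/
theorem latticeComb_eq_sum (w : ZMod d × ZMod d → ℂ) (f : 𝓢(Phase, ℂ)) :
    latticeComb w f = ∑ t, w t * ∑' b : ℤ × ℤ,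
      f ((d * ell d) • !₂[(b.1 : ℝ), (b.2 : ℝ)] +
        !₂[ell d * (t.1.val : ℝ), ell d * (t.2.val : ℝ)]) := by
  have hd : (d : ℤ) ≠ 0 := by exact_mod_cast NeZero.ne d
  let ind : ZMod d × ZMod d → ZMod d × ZMod d → ℂ := fun t s => if s = t then w t else 0
  have hsplit : ∀ a : ℤ × ℤ, w ((a.1 : ZMod d), (a.2 : ZMod d)) * f (latticePoint d a) =
      ∑ t, ind t ((a.1 : ZMod d), (a.2 : ZMod d)) * f (latticePoint d a) := fun a => by
    simp [ind, ite_mul]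
  rw [latticeComb_apply]
  simp_rw [hsplit]
  rw [Summable.tsum_finsetSum fun t _ => summable_latticeComb (ind t) f]
  refine Finset.sum_congr rfl fun t _ => ?_
  let e : ℤ × ℤ → ℤ × ℤ := fun b => (t.1.val + d * b.1, t.2.val + d * b.2)
  have he : Function.Injective e := fun b b' h => by
    simp only [e, Prod.mk.injEq, add_right_inj, mul_right_inj' hd] at h
    exact Prod.ext h.1 h.2
  rw [← tsum_mul_left, ← he.tsum_eq]
  · refine tsum_congr fun b => ?_
    have h1 : ((((e b).1 : ℤ) : ZMod d), (((e b).2 : ℤ) : ZMod d)) = t := by simp [e]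
    rw [h1, ← latticePoint_residue]
    simp [ind, e]
  · intro a ha
    have h1 : ((a.1 : ZMod d), (a.2 : ZMod d)) = t := by
      by_contra h
      exact ha (by simp only [ind]; rw [if_neg h, zero_mul])
    have h2 : ∀ (x : ℤ) (s : ZMod d), (x : ZMod d) = s → ∃ b : ℤ, x = s.val + d * b := by
      intro x s hs
      have : ((x - s.val : ℤ) : ZMod d) = 0 := by simp [hs]
      obtain ⟨b, hb⟩ := (ZMod.intCast_zmod_eq_zero_iff_dvd _ _).1 this
      exact ⟨b, by linarith⟩
    obtain ⟨b1, hb1⟩ := h2 a.1 t.1 (congrArg Prod.fst h1)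
    obtain ⟨b2, hb2⟩ := h2 a.2 t.2 (congrArg Prod.snd h1)
    exact ⟨(b1, b2), Prod.ext hb1.symm hb2.symm⟩

/-- The frequency of the displacement labelled by `a`. -/
noncomputable def dualPoint (d : ℕ) (a : ℤ × ℤ) : Phase :=
  (d * ell d)⁻¹ • !₂[(a.2 : ℝ), -(a.1 : ℝ)]

/-- Quarter turn of the integer lattice. -/
def quarterTurn : ℤ × ℤ ≃ ℤ × ℤ :=
  ⟨fun a => (a.2, -a.1), fun a => (-a.2, a.1), fun a => by simp, fun a => by simp⟩

theorem summable_norm_dualPoint (f : 𝓢(Phase, ℂ)) :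
    Summable fun a : ℤ × ℤ => ‖f (dualPoint d a)‖ := by
  have hd : (0 : ℝ) < d := by exact_mod_cast Nat.pos_of_neZero d
  have hs : (d * ell d)⁻¹ ≠ 0 := (inv_pos.2 (mul_pos hd (ell_pos d))).ne'
  have h := quarterTurn.summable_iff.2 (summable_norm_lattice f hs hs)
  refine h.congr fun a => ?_
  have e : dualPoint d a =
      !₂[(d * ell d)⁻¹ * ((quarterTurn a).1 : ℝ), (d * ell d)⁻¹ * ((quarterTurn a).2 : ℝ)] := by
    ext i
    fin_cases i <;> simp [dualPoint, quarterTurn]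
  rw [Function.comp_apply, e]

theorem latticeComb_grossWigner (ρ : Matrix (ZMod d) (ZMod d) ℂ) (f : 𝓢(Phase, ℂ)) :
    latticeComb (grossWigner d ρ) f = (1 / (2 * Real.pi) : ℂ) * ∑' a : ℤ × ℤ,
      𝓕 f (dualPoint d a) * (weyl d ((a.1 : ZMod d), (a.2 : ZMod d)) * ρ).trace := by
  have hd : (0 : ℝ) < d := by exact_mod_cast Nat.pos_of_neZero d
  have hdC : (d : ℂ) ≠ 0 := NeZero.ne _
  have hl := ell_pos d
  have hpi : (Real.pi : ℂ) ≠ 0 := by exact_mod_cast Real.pi_ne_zero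
  have hL : d * ell d ≠ 0 := (mul_pos hd hl).ne'
  have hL2 : (((d * ell d : ℝ) : ℂ) ^ 2)⁻¹ = (1 / (2 * Real.pi) : ℂ) * (1 / (d : ℂ)) := by
    have h1 : (d * ell d) ^ 2 = 2 * Real.pi * d := by
      rw [mul_pow, sq (ell d), ell_sq]; field_simp
    rw [← Complex.ofReal_pow, h1]
    push_cast
    field_simp
  have hF : Summable fun a : ℤ × ℤ => 𝓕 f (dualPoint d a) :=
    (summable_norm_dualPoint (𝓕 f)).of_norm
  have hP : ∀ t : ZMod d × ZMod d, ∑' b : ℤ × ℤ,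
      f ((d * ell d) • !₂[(b.1 : ℝ), (b.2 : ℝ)] +
        !₂[ell d * (t.1.val : ℝ), ell d * (t.2.val : ℝ)]) =
      (1 / (2 * Real.pi) : ℂ) * ((1 / (d : ℂ)) * ∑' a : ℤ × ℤ,
        omega d (symp t ((a.1 : ZMod d), (a.2 : ZMod d))) * 𝓕 f (dualPoint d a)) := by
    intro t
    rw [tsum_affine_lattice f hL, tsum_mul_left, hL2, mul_assoc, ← quarterTurn.tsum_eq]
    congr 2
    refine tsum_congr fun a => ?_
    have e1 : symp t ((a.1 : ZMod d), (a.2 : ZMod d)) =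
        ((t.1.val * a.2 - t.2.val * a.1 : ℤ) : ZMod d) := by simp [symp]
    have e2 : (2 * Real.pi * inner ℝ !₂[ell d * (t.1.val : ℝ), ell d * (t.2.val : ℝ)]
        ((d * ell d)⁻¹ • !₂[((quarterTurn a).1 : ℝ), ((quarterTurn a).2 : ℝ)]) : ℝ) =
        2 * Real.pi * (t.1.val * a.2 - t.2.val * a.1) / d := by
      simp only [quarterTurn, Equiv.coe_fn_mk, inner_smul_right, PiLp.inner_apply,
        Fin.sum_univ_two, RCLike.inner_apply, conj_trivial, Matrix.cons_val_zero,
        Matrix.cons_val_one]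
      push_cast
      field_simp
      ring
    have e3 : ((d * ell d)⁻¹ • !₂[((quarterTurn a).1 : ℝ), ((quarterTurn a).2 : ℝ)] : Phase) =
        dualPoint d a := by simp [quarterTurn, dualPoint]
    rw [e2, e3, e1, omega_intCast]
    congr 2
    push_cast
    ring
  have hsum : ∀ t : ZMod d × ZMod d, Summable fun a : ℤ × ℤ =>
      grossWigner d ρ t * (omega d (symp t ((a.1 : ZMod d), (a.2 : ZMod d))) *
        𝓕 f (dualPoint d a)) := fun t => by
    refine Summable.mul_left _ (Summable.of_norm ?_)
    simp_rw [norm_mul, norm_omega, one_mul]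
    exact summable_norm_dualPoint (𝓕 f)
  rw [latticeComb_eq_sum]
  simp_rw [hP, trace_weyl_mul_eq_sum_grossWigner, mul_left_comm (grossWigner d ρ _)]
  rw [← Finset.mul_sum, ← Finset.mul_sum]
  simp_rw [← tsum_mul_left (a := grossWigner d ρ _)]
  rw [← Summable.tsum_finsetSum fun t _ => hsum t, ← tsum_mul_left]
  congr 1
  refine tsum_congr fun a => ?_
  rw [Finset.mul_sum, Finset.mul_sum, Finset.mul_sum]
  exact Finset.sum_congr rfl fun t _ => by ring

end GrossPoisson

section Limit

/-- The coefficient of the displacement `T_a` in the phase point operator smeared with `f`. -/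
noncomputable def phaseCoeff (d : ℕ) (f : 𝓢(Phase, ℂ)) (a : ℤ × ℤ) : ℂ :=
  ∫ η : Phase, f η * Complex.exp (Complex.I * ell d * symp ((a.1 : ℝ), (a.2 : ℝ)) (η 0, η 1)
      + Complex.I * Real.pi * a.1 * a.2)

theorem phaseCoeff_eq (f : 𝓢(Phase, ℂ)) (a : ℤ × ℤ) :
    phaseCoeff d f a =
      Complex.exp (Complex.I * Real.pi * a.1 * a.2) * 𝓕 f (dualPoint d a) := by
  have hd : (0 : ℝ) < d := by exact_mod_cast Nat.pos_of_neZero d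
  have hl := ell_pos d
  rw [SchwartzMap.fourier_coe, Real.fourier_eq', ← integral_const_mul]
  refine integral_congr_ae (.of_forall fun η => ?_)
  have e : -2 * Real.pi * inner ℝ η (dualPoint d a) =
      ell d * symp ((a.1 : ℝ), (a.2 : ℝ)) (η 0, η 1) := by
    have h := ell_sq d
    have h1 : 2 * Real.pi * (d * ell d)⁻¹ = ell d := by
      field_simp at h ⊢
      linarith
    simp only [dualPoint, inner_smul_right, PiLp.inner_apply, Fin.sum_univ_two,
      RCLike.inner_apply, conj_trivial, Matrix.cons_val_zero, Matrix.cons_val_one, symp]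
    linear_combination (a.1 * η 1 - a.2 * η 0) * h1
  simp only [e, smul_eq_mul]
  rw [← mul_assoc, ← Complex.exp_add, mul_comm (f η)]
  congr 2
  push_cast
  ring

theorem norm_exp_I_pi_mul_int (a : ℤ × ℤ) :
    ‖Complex.exp (Complex.I * Real.pi * a.1 * a.2)‖ = 1 := by
  have e : Complex.I * Real.pi * a.1 * a.2 = ↑(Real.pi * a.1 * a.2) * Complex.I := by
    push_cast; ring
  rw [e, Complex.norm_exp_ofReal_mul_I]

theorem summable_norm_phaseCoeff (f : 𝓢(Phase, ℂ)) :
    Summable fun a : ℤ × ℤ => ‖phaseCoeff d f a‖ := by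
  simp_rw [phaseCoeff_eq, norm_mul, norm_exp_I_pi_mul_int, one_mul]
  exact summable_norm_dualPoint (𝓕 f)

theorem inner_phasePoint (f : 𝓢(Phase, ℂ)) (u v : Mode) :
    inner ℂ v (phasePoint d f u) = (1 / (2 * Real.pi) : ℂ) *
      ∑' a : ℤ × ℤ, phaseCoeff d f a *
        inner ℂ v (displacement d ((a.1 : ℝ), (a.2 : ℝ)) u) := by
  have hS : Summable fun a : ℤ × ℤ =>
      phaseCoeff d f a • displacement d ((a.1 : ℝ), (a.2 : ℝ)) := by
    refine Summable.of_norm_bounded (summable_norm_phaseCoeff (d := d) f) fun a => ?_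
    rw [norm_smul]
    exact mul_le_of_le_one_right (norm_nonneg _) (norm_displacement_le d _)
  have h1 := (hS.hasSum.mapL (ContinuousLinearMap.apply ℂ Mode u)).mapL (innerSL ℂ v)
  have h2 : phasePoint d f = (1 / (2 * Real.pi) : ℂ) •
      ∑' a : ℤ × ℤ, phaseCoeff d f a • displacement d ((a.1 : ℝ), (a.2 : ℝ)) := rfl
  rw [h2, smul_apply, inner_smul_right]
  congr 1
  refine h1.tsum_eq.symm.trans (tsum_congr fun a => ?_)
  simp

/-- The matrix elements of the logical displacement implemented by `T_a`. -/
noncomputable def logicalElement (j k : ZMod d) (a : ℤ × ℤ) : ℂ :=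
  if k = j + a.1 then
    Complex.exp (Complex.I * Real.pi * a.1 * a.2 / d) * omega d (a.2 * j) else 0

theorem norm_logicalElement_le (j k : ZMod d) (a : ℤ × ℤ) : ‖logicalElement j k a‖ ≤ 1 := by
  unfold logicalElement
  split_ifs
  · have e : Complex.I * Real.pi * a.1 * a.2 / d = ↑(Real.pi * a.1 * a.2 / d) * Complex.I := by
      push_cast; ring
    rw [norm_mul, norm_omega, e, Complex.norm_exp_ofReal_mul_I, one_mul]
  · simp

theorem sum_logicalElement (hd : Odd d) (ρ : Matrix (ZMod d) (ZMod d) ℂ) (a : ℤ × ℤ) :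
    Complex.exp (Complex.I * Real.pi * a.1 * a.2) *
        ∑ j, ∑ k, ρ j k * logicalElement j k a =
      (weyl d ((a.1 : ZMod d), (a.2 : ZMod d)) * ρ).trace := by
  have hdC : (d : ℂ) ≠ 0 := NeZero.ne _
  rw [trace_weyl_mul, Finset.mul_sum]
  refine Finset.sum_congr rfl fun j _ => ?_
  rw [Finset.mul_sum]
  refine Finset.sum_congr rfl fun k _ => ?_
  rw [mul_left_comm]
  congr 1
  unfold logicalElement
  split_ifs
  · obtain ⟨m, hm⟩ := hd
    have e : half d * (a.1 : ZMod d) * (a.2 : ZMod d) =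
        ((((m : ℤ) + 1) * a.1 * a.2 : ℤ) : ZMod d) := by
      rw [half, show (d + 1) / 2 = m + 1 by omega]
      push_cast
      ring
    have h2 : (d : ℂ) = 2 * m + 1 := by exact_mod_cast hm
    rw [omega_add, e, omega_intCast, ← mul_assoc, ← Complex.exp_add]
    congr 2
    push_cast
    field_simp
    rw [h2]
    ring
  · rw [mul_zero]

theorem tendsto_inner_phasePoint (g h : 𝓢(ℝ, ℂ)) (f : 𝓢(Phase, ℂ)) (j k : ZMod d) :
    Tendsto (fun p : ℝ × ℝ => ((p.1 * p.2 : ℝ) : ℂ) * inner ℂ (codeword d g h p.1 p.2 k)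
        (phasePoint d f (codeword d g h p.1 p.2 j)))
      (𝓝[>] 0 ×ˢ 𝓝[>] 0)
      (𝓝 (overlapLimit d g h * ((1 / (2 * Real.pi) : ℂ) *
        ∑' a : ℤ × ℤ, phaseCoeff d f a * logicalElement j k a))) := by
  have hpos : ∀ᶠ p : ℝ × ℝ in 𝓝[>] 0 ×ˢ 𝓝[>] 0, 0 < p.1 ∧ 0 < p.2 :=
    prod_mem_prod self_mem_nhdsWithin self_mem_nhdsWithin
  have hbd : ∀ i : ZMod d, ∃ M : ℝ, ∀ᶠ p : ℝ × ℝ in 𝓝[>] 0 ×ˢ 𝓝[>] 0,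
      p.1 * p.2 * ‖codeword d g h p.1 p.2 i‖ ^ 2 ≤ M := by
    intro i
    have h1 := (tendsto_inner_codeword (d := d) g h i i (0, 0)).norm
    simp only [Int.cast_zero, displacement_zero] at h1
    obtain ⟨M, hM⟩ := h1.isBoundedUnder_le
    refine ⟨M, ?_⟩
    filter_upwards [eventually_map.1 hM, hpos] with p hp hp0
    have hp1 := mul_pos hp0.1 hp0.2
    rw [inner_self_eq_norm_sq_to_K, norm_mul, norm_pow, Complex.norm_real,
      Real.norm_of_nonneg hp1.le] at hp
    simpa using hp
  obtain ⟨Mj, hMj⟩ := hbd j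
  obtain ⟨Mk, hMk⟩ := hbd k
  have hD : Tendsto (fun p : ℝ × ℝ => ∑' a : ℤ × ℤ, phaseCoeff d f a *
      (((p.1 * p.2 : ℝ) : ℂ) * inner ℂ (codeword d g h p.1 p.2 k)
        (displacement d ((a.1 : ℝ), (a.2 : ℝ)) (codeword d g h p.1 p.2 j))))
      (𝓝[>] 0 ×ˢ 𝓝[>] 0)
      (𝓝 (∑' a : ℤ × ℤ, phaseCoeff d f a * (overlapLimit d g h * logicalElement j k a))) := by
    refine tendsto_tsum_of_dominated_convergence
      ((summable_norm_phaseCoeff (d := d) f).mul_right (Mk + Mj))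
      (fun a => (tendsto_inner_codeword g h j k a).const_mul _) ?_
    filter_upwards [hMj, hMk, hpos] with p hj hk hp0 a
    have hp1 := mul_pos hp0.1 hp0.2
    rw [norm_mul]
    refine mul_le_mul_of_nonneg_left ?_ (norm_nonneg _)
    rw [norm_mul, Complex.norm_real, Real.norm_of_nonneg hp1.le]
    have h1 := norm_inner_le_norm (𝕜 := ℂ) (codeword d g h p.1 p.2 k)
      (displacement d ((a.1 : ℝ), (a.2 : ℝ)) (codeword d g h p.1 p.2 j))
    rw [norm_displacement_apply] at h1
    have h2 := mul_le_mul_of_nonneg_left h1 hp1.le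
    have h3 : ‖codeword d g h p.1 p.2 k‖ * ‖codeword d g h p.1 p.2 j‖ ≤
        ‖codeword d g h p.1 p.2 k‖ ^ 2 + ‖codeword d g h p.1 p.2 j‖ ^ 2 := by
      nlinarith [sq_nonneg (‖codeword d g h p.1 p.2 k‖ - ‖codeword d g h p.1 p.2 j‖),
        sq_nonneg ‖codeword d g h p.1 p.2 k‖, sq_nonneg ‖codeword d g h p.1 p.2 j‖]
    have h4 := mul_le_mul_of_nonneg_left h3 hp1.le
    rw [mul_add] at h4
    linarith
  have hfin := hD.const_mul (1 / (2 * Real.pi) : ℂ)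
  have e : (1 / (2 * Real.pi) : ℂ) *
      ∑' a : ℤ × ℤ, phaseCoeff d f a * (overlapLimit d g h * logicalElement j k a) =
      overlapLimit d g h * ((1 / (2 * Real.pi) : ℂ) *
        ∑' a : ℤ × ℤ, phaseCoeff d f a * logicalElement j k a) := by
    simp_rw [mul_left_comm _ (overlapLimit d g h), tsum_mul_left]
    rw [mul_left_comm]
  rw [e] at hfin
  refine hfin.congr fun p => ?_
  rw [inner_phasePoint]
  simp_rw [mul_left_comm _ (((p.1 * p.2 : ℝ) : ℂ)), tsum_mul_left]
  rw [mul_left_comm]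

theorem tendsto_trace_codeword (g h : 𝓢(ℝ, ℂ)) {ρ : Matrix (ZMod d) (ZMod d) ℂ}
    (hρ : ρ.trace = 1) :
    Tendsto (fun p : ℝ × ℝ => ((p.1 * p.2 : ℝ) : ℂ) *
        trace (mixture ρ (codeword d g h p.1 p.2))) (𝓝[>] 0 ×ˢ 𝓝[>] 0)
      (𝓝 (overlapLimit d g h)) := by
  have h1 : ∀ j k : ZMod d, Tendsto (fun p : ℝ × ℝ => ((p.1 * p.2 : ℝ) : ℂ) *
      inner ℂ (codeword d g h p.1 p.2 k) (codeword d g h p.1 p.2 j)) (𝓝[>] 0 ×ˢ 𝓝[>] 0)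
      (𝓝 (overlapLimit d g h * if k = j then 1 else 0)) := fun j k => by
    have h2 := tendsto_inner_codeword g h j k (0, 0)
    simpa only [Int.cast_zero, displacement_zero, add_zero, mul_zero, zero_mul, zero_div,
      Complex.exp_zero, omega_zero, mul_one] using h2
  have h3 := tendsto_finsetSum Finset.univ fun j _ =>
    tendsto_finsetSum Finset.univ fun k _ => (h1 j k).const_mul (ρ j k)
  have e : ∑ j, ∑ k, ρ j k * (overlapLimit d g h * if k = j then 1 else 0) =
      overlapLimit d g h := by
    simp_rw [mul_left_comm _ (overlapLimit d g h), ← Finset.mul_sum]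
    have : ∑ j, ∑ k, ρ j k * (if k = j then (1 : ℂ) else 0) = ρ.trace := by
      simp [Matrix.trace]
    rw [this, hρ, mul_one]
  rw [e] at h3
  refine h3.congr fun p => ?_
  rw [trace_mixture, Finset.mul_sum]
  refine Finset.sum_congr rfl fun j _ => ?_
  rw [Finset.mul_sum]
  exact Finset.sum_congr rfl fun k _ => mul_left_comm _ _ _

theorem tendsto_trace_phasePoint (hd : Odd d) (g h : 𝓢(ℝ, ℂ)) (ρ : Matrix (ZMod d) (ZMod d) ℂ)
    (f : 𝓢(Phase, ℂ)) :
    Tendsto (fun p : ℝ × ℝ => ((p.1 * p.2 : ℝ) : ℂ) *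
        trace (mixture ρ (codeword d g h p.1 p.2) ∘L phasePoint d f)) (𝓝[>] 0 ×ˢ 𝓝[>] 0)
      (𝓝 (overlapLimit d g h * latticeComb (grossWigner d ρ) f)) := by
  have h3 := tendsto_finsetSum Finset.univ fun j (_ : j ∈ Finset.univ) =>
    tendsto_finsetSum Finset.univ fun k (_ : k ∈ Finset.univ) =>
      (tendsto_inner_phasePoint g h f j k).const_mul (ρ j k)
  have hS : ∀ j k : ZMod d, Summable fun a : ℤ × ℤ =>
      ρ j k * (phaseCoeff d f a * logicalElement j k a) := fun j k => by
    refine Summable.mul_left _ (Summable.of_norm_bounded (summable_norm_phaseCoeff (d := d) f)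
      fun a => ?_)
    rw [norm_mul]
    exact mul_le_of_le_one_right (norm_nonneg _) (norm_logicalElement_le j k a)
  have e : ∑ j, ∑ k, ρ j k * (overlapLimit d g h * ((1 / (2 * Real.pi) : ℂ) *
        ∑' a : ℤ × ℤ, phaseCoeff d f a * logicalElement j k a)) =
      overlapLimit d g h * latticeComb (grossWigner d ρ) f := by
    simp_rw [mul_left_comm (ρ _ _), ← Finset.mul_sum, ← tsum_mul_left (a := ρ _ _)]
    rw [latticeComb_grossWigner]
    congr 2
    simp_rw [← Summable.tsum_finsetSum fun k _ => hS _ k]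
    rw [← Summable.tsum_finsetSum fun j _ => summable_sum fun k _ => hS j k]
    refine tsum_congr fun a => ?_
    rw [← sum_logicalElement hd, phaseCoeff_eq]
    simp_rw [mul_left_comm (ρ _ _), ← Finset.mul_sum]
    ring
  rw [e] at h3
  refine h3.congr fun p => ?_
  rw [trace_mixture_comp, Finset.mul_sum]
  refine Finset.sum_congr rfl fun j _ => ?_
  rw [Finset.mul_sum]
  exact Finset.sum_congr rfl fun k _ => mul_left_comm _ _ _

theorem eventually_trace_codeword_ne_zero {g h : 𝓢(ℝ, ℂ)} (hg : g 0 = 1) (hh : ∫ x, h x = 1)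
    {ρ : Matrix (ZMod d) (ZMod d) ℂ} (hρ : ρ.trace = 1) :
    ∀ᶠ p : ℝ × ℝ in 𝓝[>] 0 ×ˢ 𝓝[>] 0, trace (mixture ρ (codeword d g h p.1 p.2)) ≠ 0 := by
  filter_upwards [(tendsto_trace_codeword g h hρ).eventually_ne (overlapLimit_ne_zero hg hh)]
    with p hp h0
  exact hp (by rw [h0, mul_zero])

theorem tendsto_zakGross_codeword (hd : Odd d) {g h : 𝓢(ℝ, ℂ)} (hg : g 0 = 1)
    (hh : ∫ x, h x = 1) {ρ : Matrix (ZMod d) (ZMod d) ℂ} (hρ : ρ.trace = 1) (f : 𝓢(Phase, ℂ)) :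
    Tendsto (fun p : ℝ × ℝ => zakGross d ((trace (mixture ρ (codeword d g h p.1 p.2)))⁻¹ •
        mixture ρ (codeword d g h p.1 p.2)) f) (𝓝[>] 0 ×ˢ 𝓝[>] 0)
      (𝓝 (latticeComb (grossWigner d ρ) f)) := by
  have hΛ := overlapLimit_ne_zero (d := d) hg hh
  have h1 := (tendsto_trace_phasePoint hd g h ρ f).div (tendsto_trace_codeword g h hρ) hΛ
  rw [mul_div_cancel_left₀ _ hΛ] at h1
  refine h1.congr' ?_
  have hpos : ∀ᶠ p : ℝ × ℝ in 𝓝[>] 0 ×ˢ 𝓝[>] 0, 0 < p.1 ∧ 0 < p.2 :=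
    prod_mem_prod self_mem_nhdsWithin self_mem_nhdsWithin
  filter_upwards [hpos] with p hp
  have hp1 : ((p.1 * p.2 : ℝ) : ℂ) ≠ 0 := by exact_mod_cast (mul_pos hp.1 hp.2).ne'
  rw [Pi.div_apply, zakGross, trace_smul_comp, mul_div_mul_left _ _ hp1, div_eq_inv_mul]

theorem hasZakGross_latticeComb (hd : Odd d) {ρ : Matrix (ZMod d) (ZMod d) ℂ}
    (hρ : ρ.trace = 1) :
    HasZakGross d (gkpEncode d ρ) (latticeComb (grossWigner d ρ)) := fun g h hg hh =>
  ⟨fun ε δ => mixture ρ (codeword d g h ε δ),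
    fun _ _ hε hδ => isIntegralOperator_codeword ρ g h hε hδ,
    eventually_trace_codeword_ne_zero hg hh hρ, fun f => tendsto_zakGross_codeword hd hg hh hρ f⟩

theorem exists_regularization :
    ∃ g h : 𝓢(ℝ, ℂ), g 0 = 1 ∧ ∫ x, h x = 1 := by
  let φ : ContDiffBump (0 : ℝ) := ⟨1, 2, one_pos, one_lt_two⟩
  have hg : HasCompactSupport fun x => (φ x : ℂ) :=
    φ.hasCompactSupport.comp_left Complex.ofReal_zero
  have hh : HasCompactSupport fun x => (φ.normed volume x : ℂ) :=
    φ.hasCompactSupport_normed.comp_left Complex.ofReal_zero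
  refine ⟨hg.toSchwartzMap (Complex.ofRealCLM.contDiff.comp φ.contDiff),
    hh.toSchwartzMap (Complex.ofRealCLM.contDiff.comp φ.contDiff_normed), ?_, ?_⟩
  · change ((φ 0 : ℝ) : ℂ) = 1
    rw [φ.one_of_mem_closedBall (Metric.mem_closedBall_self zero_le_one), Complex.ofReal_one]
  · change ∫ x, (φ.normed volume x : ℂ) = 1
    rw [integral_complex_ofReal, φ.integral_normed, Complex.ofReal_one]

theorem hasZakGross_gkpEncode_iff (hd : Odd d) {ρ : Matrix (ZMod d) (ZMod d) ℂ}
    (hρ : ρ.trace = 1) (W : 𝓢'(Phase, ℂ)) :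
    HasZakGross d (gkpEncode d ρ) W ↔ W = latticeComb (grossWigner d ρ) := by
  refine ⟨fun hW => ?_, fun hW => hW ▸ hasZakGross_latticeComb hd hρ⟩
  obtain ⟨g, h, hg, hh⟩ := exists_regularization
  obtain ⟨A, hA, -, hlim⟩ := hW g h hg hh
  have hpos : ∀ᶠ p : ℝ × ℝ in 𝓝[>] 0 ×ˢ 𝓝[>] 0, 0 < p.1 ∧ 0 < p.2 :=
    prod_mem_prod self_mem_nhdsWithin self_mem_nhdsWithin
  ext f
  refine tendsto_nhds_unique (hlim f) ((tendsto_zakGross_codeword hd hg hh hρ f).congr' ?_)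
  filter_upwards [hpos] with p hp
  rw [(hA p.1 p.2 hp.1 hp.2).unique (isIntegralOperator_codeword ρ g h hp.1 hp.2)]

end Limit

end ZakGross

theorem corollary1 (d : ℕ) [NeZero d] (hd : Odd d)
    (ρ : Matrix (ZMod d) (ZMod d) ℂ) (hρ : ZakGross.IsState d ρ) :
    ∃ W : 𝓢'(ZakGross.Phase, ℂ),
      (∀ W' : 𝓢'(ZakGross.Phase, ℂ),
        ZakGross.HasZakGross d (ZakGross.gkpEncode d ρ) W' ↔ W' = W) ∧
      HasSum (fun a : ℤ × ℤ => ZakGross.grossWigner d ρ ((a.1 : ZMod d), (a.2 : ZMod d)) •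
        TemperedDistribution.delta (ZakGross.latticePoint d a)) W ∧
      ((∀ t : ZMod d × ZMod d, 0 ≤ ZakGross.grossWigner d ρ t) → ZakGross.IsNonneg W) ∧
      (ZakGross.IsStabilizerState d ρ → ZakGross.IsNonneg W) := by
  refine ⟨ZakGross.latticeComb (ZakGross.grossWigner d ρ),
    ZakGross.hasZakGross_gkpEncode_iff hd hρ.2, ZakGross.hasSum_latticeComb _,
    ZakGross.isNonneg_latticeComb, fun hs => ?_⟩
  exact ZakGross.isNonneg_latticeComb fun t =>
    ZakGross.grossWigner_nonneg_of_isStabilizerState hd hs t
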